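/- Let $n\ge 2$, let $B=\{z\in\mathbb C^n:|z|<1\}$, and let $d\sigma$ be the normalized surface measure on $\partial B$. For a function $F$ write $\|F\|_{\partial B}^2=\int_{\partial B}|F|^2\,d\sigma$ and $$\|F\|_{H^2}^2=\sup_{0<r<1}\int_{\partial B}|F(r\zeta)|^2\,d\sigma(\zeta),\qquad \|F\|_s^2=\frac{\Gamma(s+n+1)}{\pi^n\Gamma(s+1)}\int_B|F(z)|^2(1-|z|^2)^s\,dz\quad(s>-1).$$ For $1\le j,k\le n$, $j\ne k$, let $L_{jk}=\bar z_j\partial_k-\bar z_k\partial_j$ and $\overline L_{jk}=z_j\bar\partial_k-z_k\bar\partial_j$, where $\partial_j,\bar\partial_j$ are the Wirtinger derivatives $\partial/\partial z_j,\ \partial/\partial\bar z_j$, and let $\mathcal L_1,\dots,\mathcal L_{2n(n-1)}$ be all these operators in some fixed order. For $g$ holomorphic on $B$ with homogeneous components $g_m$ (so $g=\sum_m g_m$) put $$\|g\|_\circ^2=\sum_{m=0}^\infty m\,\frac{(n)_m}{m!}\,\|g_m\|_{\partial B}^2,\qquad (n)_m=n(n+1)\cdots(n+m-1),$$ and let $\mathcal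 A_\circ$ be the space of holomorphic $g$ on $B$ with $\|g\|_\circ<\infty$. Let $\mathcal M_\circ=\{g+\overline h: g,h\in\mathcal A_\circ\}$. For $f=g+\overline h$ with $g,h$ holomorphic on $B$ put $\|f\|_\circ^2=\|g\|_\circ^2+\|h\|_\circ^2\in[0,\infty]$ (this does not depend on the choice of $g,h$). **Theorem.** Let $f:B\to\mathbb C$ be pluriharmonic, i.e. $f\in C^2(B)$ and $\partial_j\bar\partial_kf=0$ on $B$ for all $j,k$. Then the following are equivalent: 1. $f\in\mathcal M_\circ$; 2. $\displaystyle S(f):=\sum_{j_1,\dots,j_n=1}^{2n(n-1)}\|\mathcal L_{j_1}\cdots\mathcal L_{j_n}f\|_{H^2}^2<\infty$; 3. $\displaystyle S_k(f):=\sum_{j_1,\dots,j_{n+k+1}=1}^{2n(n-1)}\|\mathcal L_{j_1}\cdots\mathcal L_{j_{n+k+1}}f\|_k^2<\infty$ for some integer $k\ge0$; 4. $S_k(f)<\infty$ for every integer $k\ge0$. Furthermore, $S^{1/2}$ and, for each integer $k\ge 0$, $S_k^{1/2}$ are (finite) seminorms on $\mathcal M_\circ$ equivalent to $\|\cdot\|_\circ$: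 there are constants $c\in(0,1]$, depending only on $n$, and $c_k\in(0,1]$, depending only on $n$ and $k$, such that for all pluriharmonic $f$ on $B$ (with values $+\infty$ allowed) $$c\,\|f\|_\circ\le S(f)^{1/2}\le c^{-1}\|f\|_\circ,\qquad c_k\,\|f\|_\circ\le S_k(f)^{1/2}\le c_k^{-1}\|f\|_\circ .$$ -/

import Mathlib

open MeasureTheory Metric Set
open scoped ENNReal ComplexConjugate

noncomputable section

namespace PHDirichlet

/-- Complex `n`-space with its Euclidean norm. -/
abbrev Cn (n : ℕ) := EuclideanSpace ℂ (Fin n)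

/-- The open unit ball of complex `n`-space. -/
def unitBall (n : ℕ) : Set (Cn n) := ball 0 1

/-- The Wirtinger derivative `∂f/∂z_j = (∂f/∂x_j - i ∂f/∂y_j) / 2`. -/
def wirt {n : ℕ} (j : Fin n) (f : Cn n → ℂ) (z : Cn n) : ℂ :=
  (fderiv ℝ f z (EuclideanSpace.single j 1)
    - Complex.I * fderiv ℝ f z (EuclideanSpace.single j Complex.I)) / 2

/-- The conjugate Wirtinger derivative `∂f/∂z̄_j = (∂f/∂x_j + i ∂f/∂y_j) / 2`. -/
def wirtBar {n : ℕ} (j : Fin n) (f : Cn n → ℂ) (z : Cn n) : ℂ :=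
  (fderiv ℝ f z (EuclideanSpace.single j 1)
    + Complex.I * fderiv ℝ f z (EuclideanSpace.single j Complex.I)) / 2

/-- `f` is pluriharmonic on the unit ball: it is `C²` there and all `∂²f/∂z_j∂z̄_k` vanish. -/
def IsPluriharmonic {n : ℕ} (f : Cn n → ℂ) : Prop :=
  ContDiffOn ℝ 2 f (unitBall n) ∧
    ∀ j k : Fin n, ∀ z ∈ unitBall n, wirt j (wirtBar k f) z = 0

/-- `f` is holomorphic on the unit ball. -/
def IsHolomorphic {n : ℕ} (f : Cn n → ℂ) : Prop :=
  DifferentiableOn ℂ f (unitBall n)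

/-- The normalized surface measure on the unit sphere. -/
def sphereMeasure (n : ℕ) : Measure (sphere (0 : Cn n) 1) :=
  ((volume : Measure (Cn n)).toSphere univ)⁻¹ • (volume : Measure (Cn n)).toSphere

/-- The squared norm of (the restriction to the unit sphere of) `F` in `L²(dσ)`. -/
def sphereNormSq {n : ℕ} (F : Cn n → ℂ) : ℝ≥0∞ :=
  ∫⁻ ζ : sphere (0 : Cn n) 1, ‖F ζ‖ₑ ^ 2 ∂(sphereMeasure n)

/-- The squared Hardy norm: the supremum over `0 < r < 1` of the squared `L²(dσ)` norms of
the dilates `ζ ↦ F (r ζ)`. -/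
def hardyNormSq {n : ℕ} (F : Cn n → ℂ) : ℝ≥0∞ :=
  ⨆ r ∈ Ioo (0 : ℝ) 1, sphereNormSq (fun ζ => F (r • ζ))

/-- The measure `Γ(s+n+1) / (π^n Γ(s+1)) (1-|z|²)^s dz` on the unit ball (used for `s > -1`,
where it is a probability measure). -/
def ballMeasure (n : ℕ) (s : ℝ) : Measure (Cn n) :=
  ((volume : Measure (Cn n)).restrict (unitBall n)).withDensity fun z =>
    ENNReal.ofReal
      (Real.Gamma (s + n + 1) / (Real.pi ^ n * Real.Gamma (s + 1)) * (1 - ‖z‖ ^ 2) ^ s)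

/-- The squared norm in `L²` of the unit ball with respect to `ballMeasure n s`. -/
def ballNormSq {n : ℕ} (s : ℝ) (F : Cn n → ℂ) : ℝ≥0∞ :=
  ∫⁻ z, ‖F z‖ₑ ^ 2 ∂(ballMeasure n s)

/-- The `2n(n-1)` indices of the tangential vector fields: an ordered pair of distinct
coordinates and a choice between the field `L_{jk}` (`false`) and its conjugate (`true`). -/
abbrev TangIdx (n : ℕ) := {p : Fin n × Fin n // p.1 ≠ p.2} × Bool

/-- The tangential vector fields `L_{jk} = z̄_j ∂_k - z̄_k ∂_j` and
`L̄_{jk} = z_j ∂̄_k - z_k ∂̄_j`. -/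
def tang {n : ℕ} : TangIdx n → (Cn n → ℂ) → Cn n → ℂ
  | (p, false), f, z => conj (z p.1.1) * wirt p.1.2 f z - conj (z p.1.2) * wirt p.1.1 f z
  | (p, true), f, z => z p.1.1 * wirtBar p.1.2 f z - z p.1.2 * wirtBar p.1.1 f z

/-- The composition `𝓛_{J 0} 𝓛_{J 1} ⋯ 𝓛_{J (m-1)} f`. -/
def tangIter {n m : ℕ} (J : Fin m → TangIdx n) (f : Cn n → ℂ) : Cn n → ℂ :=
  (List.ofFn J).foldr tang f

/-- The sum over all `m`-tuples of tangential vector fields of the squared Hardy norms of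
`𝓛_{j_1} ⋯ 𝓛_{j_m} f`. -/
def tangHardySum {n : ℕ} (m : ℕ) (f : Cn n → ℂ) : ℝ≥0∞ :=
  ∑ J : Fin m → TangIdx n, hardyNormSq (tangIter J f)

/-- The sum over all `m`-tuples of tangential vector fields of the squared weighted `L²` norms
of `𝓛_{j_1} ⋯ 𝓛_{j_m} f`. -/
def tangBallSum {n : ℕ} (m : ℕ) (s : ℝ) (f : Cn n → ℂ) : ℝ≥0∞ :=
  ∑ J : Fin m → TangIdx n, ballNormSq s (tangIter J f)

/-- The homogeneous component of degree `m` of a holomorphic `g`: the coefficient of `t^m` in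
`g (t z) = ∑ t^m g_m(z)`. -/
def homComp {n : ℕ} (g : Cn n → ℂ) (m : ℕ) (z : Cn n) : ℂ :=
  iteratedDeriv m (fun t : ℂ => g (t • z)) 0 / (m.factorial : ℂ)

/-- The square `∑_m m (n)_m / m! ‖g_m‖²` of the Dirichlet seminorm of a holomorphic `g`;
here `(n)_m = n (n+1) ⋯ (n+m-1)`. -/
def dirichletSq {n : ℕ} (g : Cn n → ℂ) : ℝ≥0∞ :=
  ∑' m : ℕ, ENNReal.ofReal (m * (n.ascFactorial m : ℝ) / (m.factorial : ℝ))
    * sphereNormSq (homComp g m)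

/-- The holomorphic Dirichlet space of the unit ball. -/
def dirichletSpace (n : ℕ) : Set (Cn n → ℂ) :=
  {g | IsHolomorphic g ∧ dirichletSq g < ∞}

/-- `f = g + h̄` on the unit ball with `g` and `h` holomorphic there. -/
def IsDecomp {n : ℕ} (f g h : Cn n → ℂ) : Prop :=
  IsHolomorphic g ∧ IsHolomorphic h ∧ ∀ z ∈ unitBall n, f z = g z + conj (h z)

/-- The pluriharmonic Dirichlet space: the sum of the holomorphic Dirichlet space and its
complex conjugate. -/
def phDirichletSpace (n : ℕ) : Set (Cn n → ℂ) :=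
  {f | ∃ g ∈ dirichletSpace n, ∃ h ∈ dirichletSpace n,
    ∀ z ∈ unitBall n, f z = g z + conj (h z)}

/-- The square of the seminorm of the pluriharmonic Dirichlet space,
`‖g + h̄‖² = ‖g‖² + ‖h‖²`. The infimum is only a way of choosing a decomposition: the value is
the same for all of them (see `phDirichletSq_eq`). -/
def phDirichletSq {n : ℕ} (f : Cn n → ℂ) : ℝ≥0∞ :=
  ⨅ (g : Cn n → ℂ) (h : Cn n → ℂ) (_ : IsDecomp f g h), dirichletSq g + dirichletSq h

/-- `N` is a (finite) seminorm on the set `V` of functions on the unit ball. -/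
structure IsSeminormOn {n : ℕ} (V : Set (Cn n → ℂ)) (N : (Cn n → ℂ) → ℝ≥0∞) : Prop where
  lt_top : ∀ f ∈ V, N f < ∞
  add_le : ∀ f ∈ V, ∀ g ∈ V, N (f + g) ≤ N f + N g
  smul_eq : ∀ (a : ℂ), ∀ f ∈ V, N (a • f) = ‖a‖ₑ * N f

/-- `c N₁ ≤ N₂ ≤ c⁻¹ N₁` on the set `V`, for some constant `0 < c ≤ 1`. -/
def EquivOn {n : ℕ} (V : Set (Cn n → ℂ)) (N₁ N₂ : (Cn n → ℂ) → ℝ≥0∞) : Prop :=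
  ∃ c : ℝ, 0 < c ∧ c ≤ 1 ∧ ∀ f ∈ V,
    ENNReal.ofReal c * N₁ f ≤ N₂ f ∧ N₂ f ≤ ENNReal.ofReal c⁻¹ * N₁ f

/-- Holomorphic components of two decompositions agree in positive degree. -/
theorem homComp_eq_of_decomp {n : ℕ} {g h g' h' : Cn n → ℂ}
    (hg : IsHolomorphic g) (hh : IsHolomorphic h)
    (hg' : IsHolomorphic g') (hh' : IsHolomorphic h')
    (e : ∀ z ∈ unitBall n, g z + conj (h z) = g' z + conj (h' z))
    {m : ℕ} (hm : m ≠ 0) (z : Cn n) : homComp g m z = homComp g' m z := by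
  have hopen : IsOpen ((fun t : ℂ => t • z) ⁻¹' unitBall n) :=
    isOpen_ball.preimage (by fun_prop)
  have h0 : (0 : ℂ) ∈ (fun t : ℂ => t • z) ⁻¹' unitBall n := by simp [unitBall]
  set U := (fun t : ℂ => t • z) ⁻¹' unitBall n with hU
  have sl : ∀ F : Cn n → ℂ, IsHolomorphic F → DifferentiableOn ℂ (fun t : ℂ => F (t • z)) U :=
    fun F hF => DifferentiableOn.comp hF
      (Differentiable.differentiableOn (by fun_prop)) (fun t ht => ht)
  have ana : ∀ F : Cn n → ℂ, IsHolomorphic F → ContDiffAt ℂ m (fun t : ℂ => F (t • z)) 0 :=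
    fun F hF => ((sl F hF).analyticAt (hopen.mem_nhds h0)).contDiffAt
  have key : ∀ t ∈ U, deriv (fun t : ℂ => g (t • z) - g' (t • z)) t = 0 := by
    intro t ht
    have hu := (((sl g hg).sub (sl g' hg')).differentiableAt (hopen.mem_nhds ht)).hasDerivAt
    have hv := (((sl h' hh').sub (sl h hh)).differentiableAt (hopen.mem_nhds ht)).hasDerivAt
    set u' := deriv ((fun t : ℂ => g (t • z)) - fun t : ℂ => g' (t • z)) t with hu'
    set v' := deriv ((fun t : ℂ => h' (t • z)) - fun t : ℂ => h (t • z)) t with hv'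
    have hu2 := hu.hasFDerivAt.restrictScalars ℝ
    have hv2 := (Complex.conjCLE.toContinuousLinearMap.hasFDerivAt).comp t
      (hv.hasFDerivAt.restrictScalars ℝ)
    have hev : (fun t : ℂ => conj (((fun t : ℂ => h' (t • z)) - fun t : ℂ => h (t • z)) t))
        =ᶠ[nhds t] ((fun t : ℂ => g (t • z)) - fun t : ℂ => g' (t • z)) := by
      filter_upwards [hopen.mem_nhds ht] with s hs
      have := e (s • z) hs
      simp only [Pi.sub_apply, map_sub]
      linear_combination (-1 : ℂ) * this
    have huq := hu2.unique (hv2.congr_of_eventuallyEq hev.symm)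
    have e1 := congrArg (fun L : ℂ →L[ℝ] ℂ => L 1) huq
    have eI := congrArg (fun L : ℂ →L[ℝ] ℂ => L Complex.I) huq
    simp at e1 eI
    have : u' = 0 := by
      have hI := Complex.I_ne_zero
      have : (2 * Complex.I) * u' = 0 := by
        rw [← e1] at eI
        linear_combination eI
      simpa using this
    exact this
  have hz : iteratedDeriv m (fun t : ℂ => g (t • z) - g' (t • z)) 0 = 0 := by
    obtain ⟨k, rfl⟩ := Nat.exists_eq_succ_of_ne_zero hm
    rw [iteratedDeriv_succ']
    have : deriv (fun t : ℂ => g (t • z) - g' (t • z)) =ᶠ[nhds 0] fun _ => (0 : ℂ) := by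
      filter_upwards [hopen.mem_nhds h0] with t ht using key t ht
    rw [this.iteratedDeriv_eq k]
    simp
  have hs := iteratedDeriv_fun_sub (ana g hg) (ana g' hg')
  rw [hz] at hs
  simp only [homComp]
  rw [sub_eq_zero.mp hs.symm]

theorem dirichletSq_eq_of_decomp {n : ℕ} {g h g' h' : Cn n → ℂ}
    (hg : IsHolomorphic g) (hh : IsHolomorphic h)
    (hg' : IsHolomorphic g') (hh' : IsHolomorphic h')
    (e : ∀ z ∈ unitBall n, g z + conj (h z) = g' z + conj (h' z)) :
    dirichletSq g = dirichletSq g' := by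
  unfold dirichletSq
  congr 1
  funext m
  rcases eq_or_ne m 0 with rfl | hm
  · simp
  · rw [show homComp g m = homComp g' m from
      funext (homComp_eq_of_decomp hg hh hg' hh' e hm)]

/-- The seminorm does not depend on the decomposition. -/
theorem phDirichletSq_eq {n : ℕ} {f g h : Cn n → ℂ} (d : IsDecomp f g h) :
    phDirichletSq f = dirichletSq g + dirichletSq h := by
  refine le_antisymm (iInf_le_of_le g (iInf_le_of_le h (iInf_le _ d))) ?_
  refine le_iInf fun g' => le_iInf fun h' => le_iInf fun d' => ?_
  have e : ∀ z ∈ unitBall n, g z + conj (h z) = g' z + conj (h' z) := fun z hz => by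
    rw [← d.2.2 z hz, d'.2.2 z hz]
  have e' : ∀ z ∈ unitBall n, h z + conj (g z) = h' z + conj (g' z) := fun z hz => by
    have := congrArg conj (e z hz)
    simp only [map_add, Complex.conj_conj] at this
    linear_combination this
  rw [dirichletSq_eq_of_decomp d.1 d.2.1 d'.1 d'.2.1 e,
    dirichletSq_eq_of_decomp d.2.1 d.1 d'.2.1 d'.1 e']

end PHDirichlet

end

/-!
The circle action `F ↦ F (e^{iθ} ·)` decomposes `L²` of every sphere orthogonally, by rotation
invariance of the surface measure and Parseval's identity (`sphereNormSq_eq_tsum_rotCoeff`). For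
`f = g + h̄` its components of weight `m` and `-m` are `g_m` and `h̄_m` for `m ≥ 1`
(`IsDecomp.rotCoeff`), and a composition of tangential fields only shifts the weights
(`tangIter_rotCoeff`). The tangential fields have degree zero, so on the sphere of radius `r` the
squared norm of `𝓛_{j_1} ⋯ 𝓛_{j_k} f` is the sum over `m` of `r^{2m}` times the squared norms of the
same derivatives of `g_m` and `h̄_m` on the unit sphere (`IsDecomp.sphereNormSq_tangIter`). Letting
`r → 1`, or integrating in polar coordinates, turns both kinds of sums of tangential derivatives
into series over `m` (`IsDecomp.tangHardySum_eq`, `IsDecomp.tangBallSum_eq`).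

It remains to know how the norms grow under differentiation. The fields `L_{jk}` and `L̄_{jk}` come
from infinitesimal rotations of the sphere, so they integrate to zero (`integral_tang_eq_zero`), and
`L̄_{jk}` is minus the adjoint of `L_{jk}`. On harmonic functions of bidegree `(p, q)` the operator
`∑ L̄_{jk} L_{jk}` is the scalar `-2p(q + n - 1)` (`SmoothFun.IsBihom.sum_tangLBar_tangL`), whence
`∑ ‖𝓛_i F‖² = (4pq + 2(n - 1)(p + q)) ‖F‖²`. The fields map bidegree `(p, q)` to `(p ∓ 1, q ± 1)`.
Starting from `(m, 0)` or `(0, m)`, after `k` steps one of the two degrees is at most `k`, so that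
each step multiplies the sum of squared norms by a factor comparable to `m`; hence the `k`-fold
derivatives together have squared norm comparable to `m^k ‖F‖²`
(`SmoothFun.IsBihom.sum_sphereSq_tangIterA_bounds`).

With `n` derivatives in the Hardy norm this gives the weight `m^n`. In the ball norms the radial
integral of `r^{2(n+m)-1} (1 - r²)^k` is comparable to `m^{-(k+1)}`, which `n + k + 1` derivatives
turn into `m^n` again. The Dirichlet weight `m (n)_m / m!` is comparable to `m^n` too
(`dirichletWeight_bounds`), and the comparison follows term by term (`exists_comparison`).

Every pluriharmonic `f` is of the form `g + h̄`: the form `∑ ∂_j f dz_j` is closed with holomorphic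
coefficients, and `g` is a primitive of it (`IsPluriharmonic.exists_isDecomp`). The seminorm axioms
come from Minkowski's inequality for sums, for the sphere and for the ball.
-/

noncomputable section

namespace PHDirichlet

/-! ### Differentiation under the integral sign and Cauchy's formula on the circle -/

/-- Differentiation under the integral sign over a compact space: a jointly continuous derivative is
bounded on a compact neighbourhood of the point, so no dominating function has to be supplied. -/
theorem hasFDerivAt_integral_of_continuousOn {𝕜 E G K : Type*} [RCLike 𝕜]
    [NormedAddCommGroup E] [NormedSpace 𝕜 E] [ProperSpace E]
    [NormedAddCommGroup G] [NormedSpace ℝ G] [NormedSpace 𝕜 G]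
    [TopologicalSpace K] [CompactSpace K] [SecondCountableTopology K] [MeasurableSpace K]
    [OpensMeasurableSpace K] {μ : Measure K} [IsFiniteMeasure μ]
    {Φ : E → K → G} {Φ' : E → K → E →L[𝕜] G} {U : Set E} (hU : IsOpen U)
    (hd : ∀ z ∈ U, ∀ t, HasFDerivAt (Φ · t) (Φ' z t) z)
    (hc' : ContinuousOn (fun p : E × K => Φ' p.1 p.2) (U ×ˢ univ))
    (hc : ∀ z ∈ U, Continuous (Φ z)) {z₀ : E} (hz₀ : z₀ ∈ U) :
    HasFDerivAt (fun z => ∫ t, Φ z t ∂μ) (∫ t, Φ' z₀ t ∂μ) z₀ := by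
  obtain ⟨ε, hε, hεU⟩ := nhds_basis_closedBall.mem_iff.1 (hU.mem_nhds hz₀)
  obtain ⟨C, hC⟩ := ((isCompact_closedBall z₀ ε).prod isCompact_univ).exists_bound_of_continuousOn
    (hc'.mono (prod_mono hεU Subset.rfl))
  have hcz : Continuous (Φ' z₀) := by
    rw [← continuousOn_univ]
    exact hc'.comp (f := fun t : K => (z₀, t)) (by fun_prop) (fun t _ => ⟨hz₀, trivial⟩)
  refine hasFDerivAt_integral_of_dominated_of_fderiv_le (bound := fun _ => C)
    (closedBall_mem_nhds z₀ hε) ?_ ?_ hcz.aestronglyMeasurable ?_ (integrable_const _) ?_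
  · filter_upwards [hU.mem_nhds hz₀] with z hz using (hc z hz).aestronglyMeasurable
  · exact (hc z₀ hz₀).integrable_of_hasCompactSupport (HasCompactSupport.of_compactSpace _)
  · exact Filter.Eventually.of_forall fun t z hz => hC (z, t) ⟨hz, trivial⟩
  · exact Filter.Eventually.of_forall fun t z hz => hd z (hεU hz) t

theorem continuousOn_integral_of_compactSpace {E G K : Type*}
    [TopologicalSpace E] [FirstCountableTopology E] [LocallyCompactSpace E]
    [NormedAddCommGroup G] [NormedSpace ℝ G]
    [TopologicalSpace K] [CompactSpace K] [SecondCountableTopology K] [MeasurableSpace K]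
    [OpensMeasurableSpace K] {μ : Measure K} [IsFiniteMeasure μ]
    {Φ : E → K → G} {U : Set E} (hU : IsOpen U)
    (hc : ContinuousOn (fun p : E × K => Φ p.1 p.2) (U ×ˢ univ)) :
    ContinuousOn (fun z => ∫ t, Φ z t ∂μ) U := by
  have := hU.locallyCompactSpace
  rw [continuousOn_iff_continuous_domRestrict]
  have : Continuous (Function.uncurry fun (z : U) (t : K) => Φ z t) :=
    hc.comp_continuous (f := fun p : U × K => ((p.1 : E), p.2)) (by fun_prop)
      (fun p => ⟨p.1.2, trivial⟩)
  have h := continuous_parametric_integral_of_continuous (μ := μ) this isCompact_univ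
  simpa [Function.comp_def, Set.domRestrict_def] using h

/-- The circle of angles, of length `2π`. -/
abbrev Torus := AddCircle (2 * Real.pi)

instance : Fact (0 < 2 * Real.pi) := ⟨Real.two_pi_pos⟩

/-- The unimodular complex number at an angle. -/
def rot (t : Torus) : ℂ := (AddCircle.toCircle t : ℂ)

theorem continuous_rot : Continuous rot :=
  continuous_subtype_val.comp AddCircle.continuous_toCircle

@[simp] theorem norm_rot (t : Torus) : ‖rot t‖ = 1 := Circle.norm_coe _

theorem fourier_eq_rot_zpow (l : ℤ) (t : Torus) : fourier l t = rot t ^ l := by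
  rw [fourier_apply, AddCircle.toCircle_zsmul, Circle.coe_zpow, rot]

/-- Cauchy's formula: the Fourier coefficients of a holomorphic function on the unit circle are
its Taylor coefficients, and those of negative index vanish. -/
theorem fourierCoeff_of_differentiableOn {u : ℂ → ℂ}
    (hu : DifferentiableOn ℂ u (closedBall 0 1)) (l : ℤ) :
    fourierCoeff (fun t : Torus => u (rot t)) l =
      if 0 ≤ l then iteratedDeriv l.toNat u 0 / (l.toNat.factorial : ℂ) else 0 := by
  -- On the unit circle `dw = i w dθ`, so a Fourier coefficient is a contour integral.
  have key : fourierCoeff (fun t : Torus => u (rot t)) l =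
      (2 * Real.pi * Complex.I)⁻¹ * ∮ w in C(0, 1), w ^ (-l - 1) * u w := by
    rw [fourierCoeff_eq_intervalIntegral _ _ 0]
    simp only [circleIntegral, zero_add]
    have : ∀ θ : ℝ, deriv (circleMap 0 1) θ • (circleMap 0 1 θ ^ (-l - 1) * u (circleMap 0 1 θ))
        = Complex.I * (fourier (-l) (θ : Torus) • u (rot (θ : Torus))) := by
      intro θ
      have hr : rot (θ : Torus) = circleMap 0 1 θ := by
        have h2 : (2 * Real.pi) / (2 * Real.pi) = 1 := div_self (by positivity)
        rw [rot, AddCircle.toCircle_apply_mk, h2, Circle.coe_exp]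
        simp [circleMap]
      have hne : circleMap 0 1 θ ≠ 0 := circleMap_ne_center one_ne_zero
      rw [fourier_eq_rot_zpow, hr, deriv_circleMap]
      simp only [smul_eq_mul]
      rw [zpow_sub_one₀ hne]
      field_simp
    simp_rw [this]
    rw [intervalIntegral.integral_const_mul, ← mul_assoc, Complex.real_smul]
    congr 1
    have := Complex.I_ne_zero
    have hpi : (Real.pi : ℂ) ≠ 0 := by exact_mod_cast Real.pi_ne_zero
    push_cast
    field_simp
  rw [key]
  split_ifs with h
  · obtain ⟨m, rfl⟩ := Int.eq_ofNat_of_zero_le h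
    have := hu.circleIntegral_one_div_sub_center_pow_smul one_pos m
    simp only [sub_zero, smul_eq_mul] at this
    have e : ∀ w : ℂ, w ^ (-(m : ℤ) - 1) * u w = 1 / w ^ (m + 1) * u w := by
      intro w
      rw [show (-(m : ℤ) - 1) = -((m + 1 : ℕ) : ℤ) by push_cast; ring, zpow_neg, zpow_natCast,
        one_div]
    simp only [Int.toNat_natCast]
    simp_rw [e]
    rw [this]
    have := Complex.two_pi_I_ne_zero
    field_simp
  · obtain ⟨m, hm⟩ : ∃ m : ℕ, -l - 1 = m := Int.eq_ofNat_of_zero_le (by omega)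
    rw [hm]
    simp only [zpow_natCast]
    have hd : DifferentiableOn ℂ (fun w : ℂ => w ^ m * u w) (closedBall 0 1) :=
      (differentiable_id.pow m).differentiableOn.mul hu
    rw [(hd.mono closure_ball_subset_closedBall).diffContOnCl.circleIntegral_eq_zero zero_le_one,
      mul_zero]

/-! ### Smoothness of holomorphic functions of several variables -/

section Osgood

variable {E : Type*} [NormedAddCommGroup E] [NormedSpace ℂ E]

/-- The derivative along a small vector is a Cauchy average over a circle, with a kernel that does
not depend on the point. -/
theorem fderiv_apply_eq_fourierCoeff {g : E → ℂ} {U : Set E} (hU : IsOpen U)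
    (hg : DifferentiableOn ℂ g U) {z v : E}
    (hv : ∀ s : ℂ, ‖s‖ ≤ 1 → z + s • v ∈ U) :
    fderiv ℂ g z v = fourierCoeff (fun t : Torus => g (z + rot t • v)) 1 := by
  have hu : DifferentiableOn ℂ (fun s : ℂ => g (z + s • v)) (closedBall 0 1) :=
    hg.comp (Differentiable.differentiableOn (by fun_prop))
      (fun s hs => hv s (by simpa using hs))
  have hz : z ∈ U := by simpa using hv 0 (by simp)
  have := fourierCoeff_of_differentiableOn hu 1
  simp only [zero_le_one, if_true, Int.toNat_one, iteratedDeriv_one, Nat.factorial_one,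
    Nat.cast_one, div_one] at this
  rw [this]
  have h1 : HasFDerivAt g (fderiv ℂ g z) (z + (0 : ℂ) • v) := by
    simpa using (hg.differentiableAt (hU.mem_nhds hz)).hasFDerivAt
  have h2 : HasDerivAt (fun s : ℂ => z + s • v) v 0 := by
    simpa using ((hasDerivAt_id (0 : ℂ)).smul_const v).const_add z
  exact (h1.comp_hasDerivAt 0 h2).deriv.symm

/-- Near a given point, the derivative along any fixed vector is a multiple of a Cauchy average,
obtained by rescaling the vector so that the disc it spans stays in the domain. -/
theorem exists_fderiv_apply_eq_fourierCoeff {g : E → ℂ} {U : Set E} (hU : IsOpen U)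
    (hg : DifferentiableOn ℂ g U) {z₀ : E} (hz₀ : z₀ ∈ U) (v : E) :
    ∃ c : ℂ, ∃ w : E, ∃ V : Set E, IsOpen V ∧ z₀ ∈ V ∧ V ⊆ U ∧
      (∀ z ∈ V, ∀ s : ℂ, ‖s‖ ≤ 1 → z + s • w ∈ U) ∧
      ∀ z ∈ V, fderiv ℂ g z v = c * fourierCoeff (fun t : Torus => g (z + rot t • w)) 1 := by
  obtain ⟨δ, hδ, hδU⟩ := Metric.isOpen_iff.1 hU z₀ hz₀
  -- The factor makes `‖a • v‖ ≤ δ / 2`; adding `1` in the denominator covers `v = 0`.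
  set a : ℝ := δ / 2 / (‖v‖ + 1) with ha
  have hapos : 0 < a := by positivity
  have hav : a * ‖v‖ ≤ δ / 2 := by
    rw [ha, div_mul_eq_mul_div, div_le_iff₀ (by positivity)]
    nlinarith [norm_nonneg v]
  have hin : ∀ z ∈ ball z₀ (δ / 2), ∀ s : ℂ, ‖s‖ ≤ 1 → z + s • ((a : ℂ) • v) ∈ U := by
    intro z hz s hs
    refine hδU ?_
    rw [mem_ball, dist_eq_norm] at hz ⊢
    have h1 : ‖s • ((a : ℂ) • v)‖ ≤ δ / 2 := by
      rw [norm_smul, norm_smul, Complex.norm_real, Real.norm_of_nonneg hapos.le]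
      calc ‖s‖ * (a * ‖v‖) ≤ 1 * (a * ‖v‖) := by gcongr
        _ ≤ δ / 2 := by rw [one_mul]; exact hav
    calc ‖z + s • ((a : ℂ) • v) - z₀‖ = ‖(z - z₀) + s • ((a : ℂ) • v)‖ := by congr 1; abel
      _ ≤ ‖z - z₀‖ + ‖s • ((a : ℂ) • v)‖ := norm_add_le _ _
      _ < δ := by linarith
  refine ⟨(a : ℂ)⁻¹, (a : ℂ) • v, ball z₀ (δ / 2), isOpen_ball, mem_ball_self (by positivity),
    (ball_subset_ball (by linarith)).trans hδU, hin, fun z hz => ?_⟩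
  rw [← fderiv_apply_eq_fourierCoeff hU hg (hin z hz), map_smul, smul_eq_mul, ← mul_assoc,
    inv_mul_cancel₀ (by exact_mod_cast hapos.ne'), one_mul]

variable [FiniteDimensional ℂ E]

/-- Holomorphic functions are only assumed to be differentiable; continuity of the derivative comes
from its representation as a Cauchy average, whose kernel does not depend on the point. -/
theorem continuousOn_fderiv_of_differentiableOn {g : E → ℂ} {U : Set E} (hU : IsOpen U)
    (hg : DifferentiableOn ℂ g U) : ContinuousOn (fderiv ℂ g) U := by
  rw [continuousOn_clm_apply]
  intro v z₀ hz₀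
  obtain ⟨c, w, V, hV, hzV, hVU, hin, he⟩ := exists_fderiv_apply_eq_fourierCoeff hU hg hz₀ v
  have : ProperSpace E := FiniteDimensional.proper ℂ E
  have hc : ContinuousOn (fun p : E × Torus => fourier (-1) p.2 • g (p.1 + rot p.2 • w))
      (V ×ˢ univ) := by
    refine ContinuousOn.smul (((fourier (-1)).continuous.comp continuous_snd).continuousOn)
      (hg.continuousOn.comp ?_ ?_)
    · have := continuous_rot
      exact Continuous.continuousOn (by fun_prop)
    · exact fun p hp => hin p.1 hp.1 _ (by simp)
  have h : ContinuousOn (fun z => fderiv ℂ g z v) V :=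
    ContinuousOn.congr (continuousOn_const.mul (continuousOn_integral_of_compactSpace hV hc)) he
  exact (h.continuousAt (hV.mem_nhds hzV)).continuousWithinAt

/-- The derivative of a holomorphic function along a fixed vector is holomorphic, by differentiating
the Cauchy average under the integral sign. -/
theorem differentiableOn_fderiv_apply {g : E → ℂ} {U : Set E} (hU : IsOpen U)
    (hg : DifferentiableOn ℂ g U) (v : E) : DifferentiableOn ℂ (fun z => fderiv ℂ g z v) U := by
  intro z₀ hz₀
  obtain ⟨c, w, V, hV, hzV, hVU, hin, he⟩ := exists_fderiv_apply_eq_fourierCoeff hU hg hz₀ v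
  have : ProperSpace E := FiniteDimensional.proper ℂ E
  have hd : ∀ z ∈ V, ∀ t : Torus, HasFDerivAt
      (fun z => fourier (-1) t • g (z + rot t • w))
      ((fourier (-1) t : ℂ) • fderiv ℂ g (z + rot t • w)) z := by
    intro z hz t
    have h1 := (hg.differentiableAt (hU.mem_nhds (hin z hz (rot t) (by simp)))).hasFDerivAt
    have h2 : HasFDerivAt (fun z => g (z + rot t • w)) (fderiv ℂ g (z + rot t • w)) z :=
      h1.comp z ((hasFDerivAt_id z).add_const (rot t • w))
    exact h2.const_smul (fourier (-1) t : ℂ)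
  have hrot := continuous_rot
  have hc' : ContinuousOn (fun p : E × Torus =>
      (fourier (-1) p.2 : ℂ) • fderiv ℂ g (p.1 + rot p.2 • w)) (V ×ˢ univ) := by
    refine ContinuousOn.smul (((fourier (-1)).continuous.comp continuous_snd).continuousOn)
      ((continuousOn_fderiv_of_differentiableOn hU hg).comp ?_ ?_)
    · exact Continuous.continuousOn (by fun_prop)
    · exact fun p hp => hin p.1 hp.1 _ (by simp)
  have hc : ∀ z ∈ V, Continuous fun t : Torus => fourier (-1) t • g (z + rot t • w) := by
    intro z hz
    refine Continuous.smul (fourier (-1)).continuous ?_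
    exact hg.continuousOn.comp_continuous (by fun_prop) (fun t => hin z hz _ (by simp))
  have h := hasFDerivAt_integral_of_continuousOn (μ := AddCircle.haarAddCircle) hV hd hc' hc hzV
  have h2 : DifferentiableAt ℂ
      (fun z => c * fourierCoeff (fun t : Torus => g (z + rot t • w)) 1) z₀ :=
    (h.differentiableAt).const_mul c
  refine (h2.congr_of_eventuallyEq ?_).differentiableWithinAt
  filter_upwards [hV.mem_nhds hzV] with z hz using he z hz

/-- A complex differentiable function on an open set of a finite-dimensional space is smooth. -/
theorem contDiffOn_of_differentiableOn {g : E → ℂ} {U : Set E} (hU : IsOpen U)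
    (hg : DifferentiableOn ℂ g U) : ContDiffOn ℂ (⊤ : ℕ∞) g U := by
  suffices h : ∀ k : ℕ, ∀ g : E → ℂ, DifferentiableOn ℂ g U → ContDiffOn ℂ k g U from
    contDiffOn_infty.2 fun k => h k g hg
  intro k
  induction k with
  | zero => exact fun g hg => contDiffOn_zero.2 hg.continuousOn
  | succ k ih =>
    intro g hg
    push_cast
    rw [contDiffOn_succ_iff_fderiv_of_isOpen hU]
    refine ⟨hg, by simp, contDiffOn_clm_apply.2 fun v =>
      ih _ (differentiableOn_fderiv_apply hU hg v)⟩

end Osgood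

variable {n : ℕ}

/-! ### Wirtinger calculus -/

theorem isOpen_unitBall : IsOpen (unitBall n) := isOpen_ball

theorem fderiv_single (F : Cn n → ℂ) (z : Cn n) (k : Fin n) (a : ℂ) :
    fderiv ℝ F z (EuclideanSpace.single k a) =
      a * wirt k F z + conj a * wirtBar k F z := by
  have : (EuclideanSpace.single k a : Cn n) =
      a.re • EuclideanSpace.single k 1 + a.im • EuclideanSpace.single k Complex.I := by
    ext i
    rcases eq_or_ne i k with rfl | h
    · simp
    · simp [h]
  rw [this, map_add, map_smul, map_smul, wirt, wirtBar, Complex.real_smul, Complex.real_smul]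
  conv_rhs => rw [← Complex.re_add_im a]
  simp only [map_add, map_mul, Complex.conj_ofReal, Complex.conj_I]
  linear_combination (a.im : ℂ) * fderiv ℝ F z (EuclideanSpace.single k Complex.I)
    * Complex.I_sq

theorem fderiv_eq_sum_wirt (F : Cn n → ℂ) (z v : Cn n) :
    fderiv ℝ F z v = ∑ k, (v k * wirt k F z + conj (v k) * wirtBar k F z) := by
  have : v = ∑ k, EuclideanSpace.single k (v k) := by
    ext i
    simp
  conv_lhs => rw [this]
  rw [map_sum]
  exact Finset.sum_congr rfl fun k _ => fderiv_single F z k (v k)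

theorem fderiv_fderiv_comm {F : Cn n → ℂ} {z : Cn n} (hF : ContDiffAt ℝ 2 F z) (v w : Cn n) :
    fderiv ℝ (fun x => fderiv ℝ F x v) z w = fderiv ℝ (fun x => fderiv ℝ F x w) z v := by
  have hd : DifferentiableAt ℝ (fderiv ℝ F) z :=
    (hF.fderiv_right (m := 1) (by norm_num)).differentiableAt one_ne_zero
  have hs := hF.isSymmSndFDerivAt (by simp)
  rw [fderiv_clm_apply hd (differentiableAt_const v),
    fderiv_clm_apply hd (differentiableAt_const w)]
  simpa using hs w v

/-- The Wirtinger derivatives at a point depend only on the germ of the function there. -/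
theorem wirt_congr {F G : Cn n → ℂ} {z : Cn n} (h : F =ᶠ[nhds z] G) (k : Fin n) :
    wirt k F z = wirt k G z ∧ wirtBar k F z = wirtBar k G z := by
  simp only [wirt, wirtBar, h.fderiv_eq, and_self]

theorem tang_congr {F G : Cn n → ℂ} {z : Cn n} (h : F =ᶠ[nhds z] G) (i : TangIdx n) :
    tang i F z = tang i G z := by
  rcases i with ⟨p, _ | _⟩ <;> simp only [tang, (wirt_congr h _).1, (wirt_congr h _).2]

theorem tang_eqOn {F G : Cn n → ℂ} {U : Set (Cn n)} (hU : IsOpen U) (h : EqOn F G U)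
    (i : TangIdx n) : EqOn (tang i F) (tang i G) U :=
  fun _ hz => tang_congr (h.eventuallyEq_of_mem (hU.mem_nhds hz)) i

theorem tangIter_cons {m : ℕ} (i : TangIdx n) (J : Fin m → TangIdx n) (F : Cn n → ℂ) :
    tangIter (Fin.cons i J : Fin (m + 1) → TangIdx n) F = tang i (tangIter J F) := by
  simp [tangIter, List.ofFn_succ]

@[simp] theorem tangIter_zero (J : Fin 0 → TangIdx n) (F : Cn n → ℂ) : tangIter J F = F := by
  simp [tangIter]

/-- Induction on the number of fields in a composition, peeling off the outermost one. -/
theorem tangIdx_induction {P : ∀ m : ℕ, (Fin m → TangIdx n) → Prop}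
    (zero : ∀ J : Fin 0 → TangIdx n, P 0 J)
    (cons : ∀ m i (J : Fin m → TangIdx n), P m J → P (m + 1) (Fin.cons i J)) :
    ∀ m J, P m J := by
  intro m
  induction m with
  | zero => exact zero
  | succ m ih =>
    intro J
    rw [← Fin.cons_self_tail J]
    exact cons m _ _ (ih _)

theorem tangIter_eqOn {F G : Cn n → ℂ} {U : Set (Cn n)} (hU : IsOpen U) (h : EqOn F G U)
    {m : ℕ} (J : Fin m → TangIdx n) : EqOn (tangIter J F) (tangIter J G) U := by
  induction m, J using tangIdx_induction with
  | zero J => simpa using h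
  | cons m i J ih =>
    rw [tangIter_cons, tangIter_cons]
    exact tang_eqOn hU ih i

theorem contDiffOn_fderiv_apply {F : Cn n → ℂ} {U : Set (Cn n)} (hU : IsOpen U)
    (hF : ContDiffOn ℝ (⊤ : ℕ∞) F U) (v : Cn n) :
    ContDiffOn ℝ (⊤ : ℕ∞) (fun z => fderiv ℝ F z v) U :=
  (hF.fderiv_of_isOpen hU (by simp)).clm_apply contDiffOn_const

theorem contDiffOn_wirt {F : Cn n → ℂ} {U : Set (Cn n)} (hU : IsOpen U)
    (hF : ContDiffOn ℝ (⊤ : ℕ∞) F U) (k : Fin n) :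
    ContDiffOn ℝ (⊤ : ℕ∞) (wirt k F) U ∧ ContDiffOn ℝ (⊤ : ℕ∞) (wirtBar k F) U := by
  have h1 := contDiffOn_fderiv_apply hU hF (EuclideanSpace.single k 1)
  have h2 := contDiffOn_fderiv_apply hU hF (EuclideanSpace.single k Complex.I)
  exact ⟨(h1.sub (contDiffOn_const.mul h2)).div_const 2,
    (h1.add (contDiffOn_const.mul h2)).div_const 2⟩

theorem contDiff_coord (j : Fin n) : ContDiff ℝ (⊤ : ℕ∞) (fun z : Cn n => z j) :=
  ((EuclideanSpace.proj (𝕜 := ℂ) (ι := Fin n) j).restrictScalars ℝ).contDiff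

theorem contDiff_conj_coord (j : Fin n) : ContDiff ℝ (⊤ : ℕ∞) (fun z : Cn n => conj (z j)) :=
  Complex.conjCLE.contDiff.comp (contDiff_coord j)

theorem contDiffOn_tang {F : Cn n → ℂ} {U : Set (Cn n)} (hU : IsOpen U)
    (hF : ContDiffOn ℝ (⊤ : ℕ∞) F U) (i : TangIdx n) : ContDiffOn ℝ (⊤ : ℕ∞) (tang i F) U := by
  rcases i with ⟨p, _ | _⟩
  · exact ((contDiff_conj_coord _).contDiffOn.mul (contDiffOn_wirt hU hF _).1).sub
      ((contDiff_conj_coord _).contDiffOn.mul (contDiffOn_wirt hU hF _).1)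
  · exact ((contDiff_coord _).contDiffOn.mul (contDiffOn_wirt hU hF _).2).sub
      ((contDiff_coord _).contDiffOn.mul (contDiffOn_wirt hU hF _).2)

theorem contDiffOn_tangIter {F : Cn n → ℂ} {U : Set (Cn n)} (hU : IsOpen U)
    (hF : ContDiffOn ℝ (⊤ : ℕ∞) F U) {m : ℕ} (J : Fin m → TangIdx n) :
    ContDiffOn ℝ (⊤ : ℕ∞) (tangIter J F) U := by
  induction m, J using tangIdx_induction with
  | zero J => simpa using hF
  | cons m i J ih =>
    rw [tangIter_cons]
    exact contDiffOn_tang hU ih i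

theorem differentiableAt_of_contDiffOn {F : Cn n → ℂ} {U : Set (Cn n)} (hU : IsOpen U)
    (hF : ContDiffOn ℝ (⊤ : ℕ∞) F U) {z : Cn n} (hz : z ∈ U) : DifferentiableAt ℝ F z :=
  (hF.differentiableOn (by simp)).differentiableAt (hU.mem_nhds hz)

theorem tangIter_add_eqOn {F G : Cn n → ℂ} {U : Set (Cn n)} (hU : IsOpen U)
    (hF : ContDiffOn ℝ (⊤ : ℕ∞) F U) (hG : ContDiffOn ℝ (⊤ : ℕ∞) G U)
    {m : ℕ} (J : Fin m → TangIdx n) :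
    EqOn (tangIter J (F + G)) (tangIter J F + tangIter J G) U := by
  induction m, J using tangIdx_induction with
  | zero J => intro z _; simp
  | cons m i J ih =>
    rw [tangIter_cons, tangIter_cons, tangIter_cons]
    intro z hz
    rw [tang_eqOn hU ih i hz]
    have h := fderiv_add (differentiableAt_of_contDiffOn hU (contDiffOn_tangIter hU hF J) hz)
      (differentiableAt_of_contDiffOn hU (contDiffOn_tangIter hU hG J) hz)
    rcases i with ⟨p, _ | _⟩ <;> simp only [tang, wirt, wirtBar, h, Pi.add_apply,
      add_apply] <;> ring

theorem tang_const_smul (a : ℂ) (F : Cn n → ℂ) (i : TangIdx n) :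
    tang i (a • F) = a • tang i F := by
  funext z
  have h : fderiv ℝ (a • F) z = a • fderiv ℝ F z :=
    congrFun (fderiv_const_smul_field (𝕜 := ℝ) (f := F) a) z
  rcases i with ⟨p, _ | _⟩ <;> simp only [tang, wirt, wirtBar, h, Pi.smul_apply,
    smul_apply, smul_eq_mul] <;> ring

theorem tangIter_const_smul (a : ℂ) (F : Cn n → ℂ) {m : ℕ} (J : Fin m → TangIdx n) :
    tangIter J (a • F) = a • tangIter J F := by
  induction m, J using tangIdx_induction with
  | zero J => simp
  | cons m i J ih => rw [tangIter_cons, tangIter_cons, ih, tang_const_smul]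

theorem tang_comp_smul (r : ℝ) (F : Cn n → ℂ) (i : TangIdx n) :
    tang i (fun z => F (r • z)) = fun z => tang i F (r • z) := by
  funext z
  have h : fderiv ℝ (fun z => F (r • z)) z = r • fderiv ℝ F (r • z) := fderiv_comp_smul r
  rcases i with ⟨p, _ | _⟩ <;> simp only [tang, wirt, wirtBar, h,
    smul_apply, Complex.real_smul, PiLp.smul_apply, map_mul,
    Complex.conj_ofReal] <;> ring

theorem tangIter_comp_smul (r : ℝ) (F : Cn n → ℂ) {m : ℕ} (J : Fin m → TangIdx n) :
    tangIter J (fun z => F (r • z)) = fun z => tangIter J F (r • z) := by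
  induction m, J using tangIdx_induction with
  | zero J => simp
  | cons m i J ih => rw [tangIter_cons, tangIter_cons, ih, tang_comp_smul]

/-- The tangential fields have degree zero, so they preserve homogeneity. -/
theorem tangIter_homogeneous {F : Cn n → ℂ} {d : ℕ}
    (hF : ∀ (r : ℝ) z, F (r • z) = (r : ℂ) ^ d * F z) {m : ℕ} (J : Fin m → TangIdx n)
    (r : ℝ) (z : Cn n) : tangIter J F (r • z) = (r : ℂ) ^ d * tangIter J F z := by
  have h1 := congrFun (tangIter_comp_smul r F J) z
  have h2 : (fun z => F (r • z)) = ((r : ℂ) ^ d) • F := funext fun z => by simp [hF]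
  rw [← h1, h2, tangIter_const_smul]
  rfl

theorem tang_const (c : ℂ) (i : TangIdx n) : tang i (fun _ : Cn n => c) = 0 := by
  funext z
  rcases i with ⟨p, _ | _⟩ <;> simp [tang, wirt, wirtBar]

theorem tangIter_const (c : ℂ) {m : ℕ} (J : Fin (m + 1) → TangIdx n) :
    tangIter J (fun _ : Cn n => c) = 0 := by
  have key : ∀ m (J : Fin m → TangIdx n), ∃ c', tangIter J (fun _ : Cn n => c) = fun _ => c' := by
    intro m J
    induction m, J using tangIdx_induction with
    | zero J => exact ⟨c, by simp⟩
    | cons m i J ih =>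
      obtain ⟨c', h⟩ := ih
      exact ⟨0, by rw [tangIter_cons, h, tang_const]; rfl⟩
  obtain ⟨c', h⟩ := key m (Fin.tail J)
  rw [← Fin.cons_self_tail J, tangIter_cons, h, tang_const]

/-! ### Homogeneous components -/

theorem IsHolomorphic.contDiffOn {g : Cn n → ℂ} (hg : IsHolomorphic g) :
    ContDiffOn ℝ (⊤ : ℕ∞) g (unitBall n) :=
  (contDiffOn_of_differentiableOn isOpen_unitBall hg).restrict_scalars ℝ

/-- The homogeneous component of degree `m` is the `m`-th Taylor form at the origin. -/
theorem homComp_eq_iteratedFDeriv {g : Cn n → ℂ} (hg : IsHolomorphic g) (m : ℕ) (z : Cn n) :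
    homComp g m z = iteratedFDeriv ℂ m g 0 (fun _ => z) / (m.factorial : ℂ) := by
  have hU : IsOpen (ContinuousLinearMap.toSpanSingleton ℂ z ⁻¹' unitBall n) :=
    isOpen_unitBall.preimage (ContinuousLinearMap.continuous _)
  have h0 : (0 : Cn n) ∈ unitBall n := by simp [unitBall]
  have h := (ContinuousLinearMap.toSpanSingleton ℂ z).iteratedFDerivWithin_comp_right (x := 0)
    (contDiffOn_of_differentiableOn isOpen_unitBall hg) isOpen_unitBall.uniqueDiffOn
    hU.uniqueDiffOn (by simpa using h0) (i := m) (by exact_mod_cast le_top)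
  rw [iteratedFDerivWithin_of_isOpen _ hU (by simpa using h0),
    iteratedFDerivWithin_of_isOpen _ isOpen_unitBall (by simpa using h0)] at h
  rw [homComp, iteratedDeriv_eq_iteratedFDeriv]
  have e : (fun t : ℂ => g (t • z)) = g ∘ ContinuousLinearMap.toSpanSingleton ℂ z := by
    ext t; simp
  rw [e, h]
  simp

theorem homComp_smul {g : Cn n → ℂ} (hg : IsHolomorphic g) (m : ℕ) (c : ℂ) (z : Cn n) :
    homComp g m (c • z) = c ^ m * homComp g m z := by
  have := (iteratedFDeriv ℂ m g 0).map_smul_univ (fun _ => c) (fun _ => z)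
  rw [homComp_eq_iteratedFDeriv hg, homComp_eq_iteratedFDeriv hg, this]
  simp [mul_div_assoc]

theorem homComp_real_smul {g : Cn n → ℂ} (hg : IsHolomorphic g) (m : ℕ) (r : ℝ) (z : Cn n) :
    homComp g m (r • z) = (r : ℂ) ^ m * homComp g m z := by
  rw [← homComp_smul hg]
  rfl

theorem homComp_zero (g : Cn n → ℂ) :
    homComp g 0 = fun _ => g 0 := by
  funext z
  simp [homComp]

theorem contDiff_homComp {g : Cn n → ℂ} (hg : IsHolomorphic g) (m : ℕ) :
    ContDiff ℂ (⊤ : ℕ∞) (homComp g m) := by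
  rw [funext (homComp_eq_iteratedFDeriv hg m)]
  refine ContDiff.div_const ?_ _
  exact (iteratedFDeriv ℂ m g 0).contDiff.comp (contDiff_pi.2 fun _ => contDiff_id)

/-- Euler's relation for a homogeneous component. -/
theorem fderiv_homComp_self {g : Cn n → ℂ} (hg : IsHolomorphic g) (m : ℕ) (z : Cn n) :
    fderiv ℂ (homComp g m) z z = m * homComp g m z := by
  have hd := ((contDiff_homComp hg m).differentiable (by simp) z).hasFDerivAt
  have h1 : HasFDerivAt (homComp g m) (fderiv ℂ (homComp g m) z) ((1 : ℂ) • z) := by simpa using hd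
  have h2 : HasDerivAt (fun c : ℂ => c • z) z 1 := by
    simpa using (hasDerivAt_id (1 : ℂ)).smul_const z
  have h3 := h1.comp_hasDerivAt 1 h2
  have h4 : HasDerivAt (fun c : ℂ => c ^ m * homComp g m z) (m * homComp g m z) 1 := by
    simpa using (hasDerivAt_pow m (1 : ℂ)).mul_const (homComp g m z)
  refine h3.unique (h4.congr_of_eventuallyEq (Filter.Eventually.of_forall fun c => ?_))
  exact homComp_smul hg m c z

/-- The Cauchy–Riemann equations. -/
theorem wirt_of_differentiableAt {F : Cn n → ℂ} {z : Cn n} (hF : DifferentiableAt ℂ F z)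
    (k : Fin n) :
    wirt k F z = fderiv ℂ F z (EuclideanSpace.single k 1) ∧ wirtBar k F z = 0 := by
  have h : fderiv ℝ F z = (fderiv ℂ F z).restrictScalars ℝ :=
    (hF.hasFDerivAt.restrictScalars ℝ).fderiv
  have hI : (EuclideanSpace.single k Complex.I : Cn n) =
      Complex.I • EuclideanSpace.single k 1 := by
    ext i
    rcases eq_or_ne i k with rfl | h
    · simp
    · simp [h]
  have hI2 : fderiv ℂ F z (EuclideanSpace.single k Complex.I) =
      Complex.I * fderiv ℂ F z (EuclideanSpace.single k 1) := by
    rw [hI, map_smul, smul_eq_mul]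
  simp only [wirt, wirtBar, h, ContinuousLinearMap.coe_restrictScalars', hI2]
  constructor
  · linear_combination (-(fderiv ℂ F z (EuclideanSpace.single k 1)) / 2) * Complex.I_sq
  · linear_combination ((fderiv ℂ F z (EuclideanSpace.single k 1)) / 2) * Complex.I_sq

theorem wirt_conj (F : Cn n → ℂ) (z : Cn n) (k : Fin n) :
    wirt k (fun z => conj (F z)) z = conj (wirtBar k F z) ∧
      wirtBar k (fun z => conj (F z)) z = conj (wirt k F z) := by
  have h : fderiv ℝ (fun z => conj (F z)) z =
      (Complex.conjCLE : ℂ →L[ℝ] ℂ).comp (fderiv ℝ F z) :=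
    Complex.conjCLE.comp_fderiv
  simp only [wirt, wirtBar, h]
  constructor <;> simp [sub_eq_add_neg, Complex.conj_ofNat]

/-! ### Invariance of the surface measure -/

/-- The action of a linear isometry on the unit sphere. -/
def sphereMap (R : Cn n ≃ₗᵢ[ℝ] Cn n) (ζ : sphere (0 : Cn n) 1) : sphere (0 : Cn n) 1 :=
  ⟨R ζ, by simp⟩

theorem continuous_sphereMap (R : Cn n ≃ₗᵢ[ℝ] Cn n) : Continuous (sphereMap R) :=
  (R.continuous.comp continuous_subtype_val).subtype_mk _

open scoped Pointwise in
theorem measurePreserving_sphereMap_toSphere (R : Cn n ≃ₗᵢ[ℝ] Cn n) :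
    MeasurePreserving (sphereMap R) (volume : Measure (Cn n)).toSphere
      (volume : Measure (Cn n)).toSphere := by
  refine ⟨(continuous_sphereMap R).measurable, Measure.ext fun s hs => ?_⟩
  rw [Measure.map_apply (continuous_sphereMap R).measurable hs, Measure.toSphere_apply' _ hs,
    Measure.toSphere_apply' _ ((continuous_sphereMap R).measurable hs)]
  congr 1
  have hR := R.measurePreserving
  have e : Ioo (0 : ℝ) 1 • (Subtype.val '' (sphereMap R ⁻¹' s)) =
      R.toMeasurableEquiv ⁻¹' (Ioo (0 : ℝ) 1 • (Subtype.val '' s)) := by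
    ext x
    simp only [mem_smul, mem_image, mem_preimage, Subtype.exists, exists_and_right,
      exists_eq_right]
    constructor
    · rintro ⟨r, hr, y, ⟨hy, hy'⟩, rfl⟩
      refine ⟨r, hr, R y, ⟨by simpa using hy, hy'⟩, ?_⟩
      exact (R.map_smul r y).symm
    · rintro ⟨r, hr, y, ⟨hy, hy'⟩, hxy⟩
      refine ⟨r, hr, R.symm y, ⟨by simpa using hy, ?_⟩, ?_⟩
      · simpa [sphereMap] using hy'
      · rw [← R.symm.map_smul, hxy]
        exact R.symm_apply_apply x
  rw [e]
  exact hR.measure_preimage_equiv (f := R.toMeasurableEquiv) _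

theorem measurePreserving_sphereMap (R : Cn n ≃ₗᵢ[ℝ] Cn n) :
    MeasurePreserving (sphereMap R) (sphereMeasure n) (sphereMeasure n) :=
  (measurePreserving_sphereMap_toSphere R).smul_measure _

instance : IsFiniteMeasure (sphereMeasure n) := by
  constructor
  rw [sphereMeasure, Measure.smul_apply, smul_eq_mul]
  exact (ENNReal.inv_mul_le_one _).trans_lt ENNReal.one_lt_top

open scoped InnerProductSpace in
/-- Functions integrate to zero against infinitesimal rotations of the sphere. -/
theorem integral_sphere_fderiv_eq_zero {u : Cn n → ℂ} (hu : ContDiff ℝ 1 u)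
    {X : Cn n →L[ℝ] Cn n} (hX : ∀ x y, ⟪X x, y⟫_ℝ = -⟪x, X y⟫_ℝ) :
    ∫ ζ : sphere (0 : Cn n) 1, fderiv ℝ u ζ (X ζ) ∂sphereMeasure n = 0 := by
  have hs : X ∈ skewAdjoint (Cn n →L[ℝ] Cn n) := by
    rw [skewAdjoint.mem_iff, ContinuousLinearMap.star_eq_adjoint, eq_comm,
      ContinuousLinearMap.eq_adjoint_iff]
    intro x y
    simp [hX]
  let _ : NormedAlgebra ℚ (Cn n →L[ℝ] Cn n) := NormedAlgebra.restrictScalars ℚ ℝ _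
  -- The rotations `exp (tX)` preserve the surface measure, so the integral of `u ∘ exp (tX)` does
  -- not depend on `t`. The claim is that its derivative at `t = 0` vanishes.
  have hexp : ∀ t : ℝ, NormedSpace.exp (t • X) ∈ unitary (Cn n →L[ℝ] Cn n) := fun t =>
    NormedSpace.exp_mem_unitary_of_mem_skewAdjoint (skewAdjoint.smul_mem t hs)
  have hec : Continuous fun t : ℝ => NormedSpace.exp (t • X) :=
    NormedSpace.exp_continuous.comp (by fun_prop)
  have hd : ∀ t ∈ (univ : Set ℝ), ∀ ζ : sphere (0 : Cn n) 1,
      HasFDerivAt (fun t : ℝ => u (NormedSpace.exp (t • X) ζ))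
        (ContinuousLinearMap.toSpanSingleton ℝ (fderiv ℝ u (NormedSpace.exp (t • X) ζ)
          ((NormedSpace.exp (t • X) * X) ζ))) t := by
    intro t _ ζ
    have h1 : HasDerivAt (fun t : ℝ => NormedSpace.exp (t • X) (ζ : Cn n))
        ((NormedSpace.exp (t • X) * X) ζ) t := by
      simpa using (hasDerivAt_exp_smul_const X t).clm_apply (hasDerivAt_const t (ζ : Cn n))
    have h2 := ((hu.differentiable one_ne_zero _).hasFDerivAt.comp_hasDerivAt t h1).hasFDerivAt
    exact h2
  have hc' : ContinuousOn (fun p : ℝ × sphere (0 : Cn n) 1 =>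
      ContinuousLinearMap.toSpanSingleton ℝ (fderiv ℝ u (NormedSpace.exp (p.1 • X) p.2)
          ((NormedSpace.exp (p.1 • X) * X) p.2))) (univ ×ˢ univ) := by
    have h1 : Continuous fun p : ℝ × sphere (0 : Cn n) 1 =>
        NormedSpace.exp (p.1 • X) (p.2 : Cn n) := (hec.comp continuous_fst).clm_apply (by fun_prop)
    have h2 : Continuous fun p : ℝ × sphere (0 : Cn n) 1 =>
        (NormedSpace.exp (p.1 • X) * X) (p.2 : Cn n) := by
      exact (hec.comp continuous_fst).clm_apply (X.continuous.comp (by fun_prop))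
    have h3 := (hu.continuous_fderiv one_ne_zero).comp h1
    have h4 := h3.clm_apply h2
    rw [continuousOn_clm_apply]
    intro y
    simpa [Pi.mul_def] using (continuous_const (y := (y : ℂ))).mul h4
  have h := hasFDerivAt_integral_of_continuousOn (μ := sphereMeasure n) isOpen_univ hd hc'
    (fun t _ => hu.continuous.comp (by fun_prop)) (mem_univ (0 : ℝ))
  have hconst : ∀ t : ℝ, ∫ ζ : sphere (0 : Cn n) 1, u (NormedSpace.exp (t • X) ζ) ∂sphereMeasure n
      = ∫ ζ : sphere (0 : Cn n) 1, u ζ ∂sphereMeasure n := by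
    intro t
    have hm := measurePreserving_sphereMap (Unitary.linearIsometryEquiv ⟨_, hexp t⟩)
    have hu' : Continuous fun ζ : sphere (0 : Cn n) 1 => u ζ :=
      hu.continuous.comp continuous_subtype_val
    have h := integral_map (μ := sphereMeasure n) hm.measurable.aemeasurable
      (f := fun ζ : sphere (0 : Cn n) 1 => u ζ) hu'.aestronglyMeasurable
    rw [hm.map_eq] at h
    exact h.symm
  rw [funext hconst] at h
  have h0 := h.unique (hasFDerivAt_const _ _)
  have hint : Integrable (fun ζ : sphere (0 : Cn n) 1 => ContinuousLinearMap.toSpanSingleton ℝ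
      (fderiv ℝ u (NormedSpace.exp ((0 : ℝ) • X) ζ) ((NormedSpace.exp ((0 : ℝ) • X) * X) ζ)))
      (sphereMeasure n) := by
    refine Continuous.integrable_of_hasCompactSupport ?_ (HasCompactSupport.of_compactSpace _)
    rw [← continuousOn_univ]
    exact hc'.comp (f := fun ζ : sphere (0 : Cn n) 1 => ((0 : ℝ), ζ)) (by fun_prop)
      (fun _ _ => ⟨trivial, trivial⟩)
  have h1 := ContinuousLinearMap.integral_apply hint (1 : ℝ)
  rw [show (∫ ζ, _ ∂sphereMeasure n : ℝ →L[ℝ] ℂ) = 0 from h0] at h1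
  have e0 : (0 : ℝ) • X = 0 := by ext; simp
  simp only [e0, NormedSpace.exp_zero] at h1
  simpa using h1.symm

/-! ### Tangential fields as infinitesimal rotations -/

/-- The infinitesimal rotation `z ↦ c z̄_j e_k - c z̄_k e_j`. -/
def rotGen (j k : Fin n) (c : ℂ) : Cn n →L[ℝ] Cn n :=
  LinearMap.toContinuousLinearMap
    { toFun := fun z => EuclideanSpace.single k (c * conj (z j)) -
        EuclideanSpace.single j (c * conj (z k))
      map_add' := fun x y => by
        ext i
        simp only [PiLp.add_apply, PiLp.sub_apply, PiLp.single_apply, map_add]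
        split_ifs <;> ring
      map_smul' := fun r x => by
        ext i
        simp only [PiLp.smul_apply, PiLp.sub_apply, PiLp.single_apply, Complex.real_smul, map_mul,
          Complex.conj_ofReal, RingHom.id_apply]
        split_ifs <;> ring }

theorem rotGen_apply (j k : Fin n) (c : ℂ) (z : Cn n) :
    rotGen j k c z = EuclideanSpace.single k (c * conj (z j)) -
        EuclideanSpace.single j (c * conj (z k)) := rfl

open scoped InnerProductSpace in
theorem real_inner_single (k : Fin n) (a : ℂ) (y : Cn n) :
    ⟪(EuclideanSpace.single k a : Cn n), y⟫_ℝ = (conj a * y k).re := by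
  rw [PiLp.inner_apply, Finset.sum_eq_single k]
  · simp [Complex.inner]
    ring
  · intro i _ h
    simp [h]
  · simp

open scoped InnerProductSpace in
theorem rotGen_skew (j k : Fin n) (c : ℂ) (x y : Cn n) :
    ⟪rotGen j k c x, y⟫_ℝ = -⟪x, rotGen j k c y⟫_ℝ := by
  rw [real_inner_comm _ x, rotGen_apply, rotGen_apply, inner_sub_left, inner_sub_left]
  simp only [real_inner_single, map_mul, Complex.conj_conj, Complex.mul_re, Complex.mul_im,
    Complex.conj_re, Complex.conj_im]
  ring

/-- The derivative along `rotGen j k c` is a combination of `L_{jk}` and `L̄_{jk}`. -/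
theorem fderiv_rotGen (u : Cn n → ℂ) (j k : Fin n) (h : j ≠ k) (c : ℂ) (z : Cn n) :
    fderiv ℝ u z (rotGen j k c z) = c * tang (⟨(j, k), h⟩, false) u z +
      conj c * tang (⟨(j, k), h⟩, true) u z := by
  rw [rotGen_apply, map_sub, fderiv_single, fderiv_single]
  simp only [tang, map_mul, Complex.conj_conj]
  ring

theorem integrable_sphere {F : Cn n → ℂ} (hF : Continuous F) :
    Integrable (fun ζ : sphere (0 : Cn n) 1 => F ζ) (sphereMeasure n) :=
  (hF.comp continuous_subtype_val).integrable_of_hasCompactSupport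
    (HasCompactSupport.of_compactSpace _)

/-- The tangential fields integrate to zero over the sphere. The infinitesimal rotations `rotGen j k
c` give this for `c L_{jk} + c̄ L̄_{jk}`, and `c = 1`, `c = i` separate the two fields. -/
theorem integral_tang_eq_zero {u : Cn n → ℂ} (hu : ContDiff ℝ (⊤ : ℕ∞) u) (i : TangIdx n) :
    ∫ ζ : sphere (0 : Cn n) 1, tang i u ζ ∂sphereMeasure n = 0 := by
  obtain ⟨⟨⟨j, k⟩, h⟩, b⟩ := i
  have hint : ∀ b, Integrable (fun ζ : sphere (0 : Cn n) 1 => tang (⟨(j, k), h⟩, b) u ζ)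
      (sphereMeasure n) := fun b => integrable_sphere
    (contDiffOn_univ.1 (contDiffOn_tang isOpen_univ hu.contDiffOn _)).continuous
  have key : ∀ c : ℂ, c * (∫ ζ : sphere (0 : Cn n) 1, tang (⟨(j, k), h⟩, false) u ζ
      ∂sphereMeasure n) + conj c * (∫ ζ : sphere (0 : Cn n) 1, tang (⟨(j, k), h⟩, true) u ζ
      ∂sphereMeasure n) = 0 := by
    intro c
    have h0 := integral_sphere_fderiv_eq_zero (hu.of_le (by exact_mod_cast le_top))
      (rotGen_skew j k c)
    simp_rw [fderiv_rotGen u j k h c] at h0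
    rw [integral_add ((hint _).const_mul _) ((hint _).const_mul _), integral_const_mul,
      integral_const_mul] at h0
    exact h0
  have h1 := key 1
  have hI := key Complex.I
  simp only [map_one, one_mul, Complex.conj_I] at h1 hI
  have hI0 := Complex.I_ne_zero
  cases b
  · refine (mul_eq_zero.1 (?_ : 2 * Complex.I * _ = 0)).resolve_left (by simp)
    linear_combination Complex.I * h1 + hI
  · refine (mul_eq_zero.1 (?_ : 2 * Complex.I * _ = 0)).resolve_left (by simp)
    linear_combination Complex.I * h1 - hI

/-! ### The algebra of smooth functions and its Wirtinger derivations -/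

/-- The algebra of smooth functions on `ℂⁿ`. -/
def SmoothFun (n : ℕ) : Subalgebra ℂ (Cn n → ℂ) where
  carrier := {F | ContDiff ℝ (⊤ : ℕ∞) F}
  mul_mem' := fun hF hG => mem_ofPred_eq ▸ (mem_ofPred.1 hF).mul (mem_ofPred.1 hG)
  add_mem' := fun hF hG => mem_ofPred_eq ▸ (mem_ofPred.1 hF).add (mem_ofPred.1 hG)
  algebraMap_mem' := fun c => mem_ofPred.2 (contDiff_const (c := c))

namespace SmoothFun

theorem smooth (F : SmoothFun n) : ContDiff ℝ (⊤ : ℕ∞) (F : Cn n → ℂ) := F.2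

theorem diffAt (F : SmoothFun n) (z : Cn n) :
    DifferentiableAt ℝ (F : Cn n → ℂ) z := (smooth F).differentiable (by simp) z

/-- The directional derivative along a fixed vector. -/
def dir (v : Cn n) : Derivation ℂ (SmoothFun n) (SmoothFun n) :=
  Derivation.mk'
    { toFun := fun F => ⟨fun z => fderiv ℝ (F : Cn n → ℂ) z v,
        contDiffOn_univ.1 (contDiffOn_fderiv_apply isOpen_univ (smooth F).contDiffOn v)⟩
      map_add' := fun F G => Subtype.ext <| funext fun z => by
        change fderiv ℝ ((F : Cn n → ℂ) + (G : Cn n → ℂ)) z v =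
          fderiv ℝ (F : Cn n → ℂ) z v + fderiv ℝ (G : Cn n → ℂ) z v
        rw [fderiv_add (diffAt F z) (diffAt G z)]
        rfl
      map_smul' := fun c F => Subtype.ext <| funext fun z => by
        have := congrFun (fderiv_const_smul_field (𝕜 := ℝ) (f := (F : Cn n → ℂ)) c) z
        change fderiv ℝ (c • (F : Cn n → ℂ)) z v = c • fderiv ℝ (F : Cn n → ℂ) z v
        rw [this]
        rfl }
    fun F G => Subtype.ext <| funext fun z => by
      change fderiv ℝ ((F : Cn n → ℂ) * (G : Cn n → ℂ)) z v =
        F.1 z * fderiv ℝ (G : Cn n → ℂ) z v + G.1 z * fderiv ℝ (F : Cn n → ℂ) z v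
      rw [fderiv_mul (diffAt F z) (diffAt G z)]
      rfl

theorem dir_comm (v w : Cn n) (F : SmoothFun n) : dir v (dir w F) = dir w (dir v F) :=
  Subtype.ext <| funext fun _ =>
    (fderiv_fderiv_comm (contDiff_infty.1 (smooth F) 2).contDiffAt v w).symm

/-- The Wirtinger derivation `∂_k`. -/
def dz (k : Fin n) : Derivation ℂ (SmoothFun n) (SmoothFun n) :=
  (2⁻¹ : ℂ) • (dir (EuclideanSpace.single k 1) -
    Complex.I • dir (EuclideanSpace.single k Complex.I))

/-- The conjugate Wirtinger derivation `∂̄_k`. -/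
def dzb (k : Fin n) : Derivation ℂ (SmoothFun n) (SmoothFun n) :=
  (2⁻¹ : ℂ) • (dir (EuclideanSpace.single k 1) +
    Complex.I • dir (EuclideanSpace.single k Complex.I))

theorem dz_apply (k : Fin n) (F : SmoothFun n) (z : Cn n) :
    (dz k F : Cn n → ℂ) z = wirt k F z := by
  change (2⁻¹ : ℂ) * (fderiv ℝ F z _ - Complex.I * fderiv ℝ F z _) = _
  rw [wirt]; ring

theorem dzb_apply (k : Fin n) (F : SmoothFun n) (z : Cn n) :
    (dzb k F : Cn n → ℂ) z = wirtBar k F z := by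
  change (2⁻¹ : ℂ) * (fderiv ℝ F z _ + Complex.I * fderiv ℝ F z _) = _
  rw [wirtBar]; ring

theorem dz_eq (k : Fin n) (F : SmoothFun n) : dz k F =
    (2⁻¹ : ℂ) • (dir (EuclideanSpace.single k 1) F -
      Complex.I • dir (EuclideanSpace.single k Complex.I) F) := rfl

theorem dzb_eq (k : Fin n) (F : SmoothFun n) : dzb k F =
    (2⁻¹ : ℂ) • (dir (EuclideanSpace.single k 1) F +
      Complex.I • dir (EuclideanSpace.single k Complex.I) F) := rfl

theorem dz_comm (j k : Fin n) (F : SmoothFun n) : dz j (dz k F) = dz k (dz j F) := by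
  simp only [dz_eq, Derivation.map_smul, map_sub,
    dir_comm (EuclideanSpace.single k _) (EuclideanSpace.single j _)]
  module

theorem dz_dzb_comm (j k : Fin n) (F : SmoothFun n) : dz j (dzb k F) = dzb k (dz j F) := by
  simp only [dz_eq, dzb_eq, Derivation.map_smul, map_sub, map_add,
    dir_comm (EuclideanSpace.single k _) (EuclideanSpace.single j _)]
  module

/-- The coordinate function `z_j`. -/
def zc (j : Fin n) : SmoothFun n := ⟨fun z => z j, contDiff_coord j⟩

/-- The conjugate coordinate function `z̄_j`. -/
def zb (j : Fin n) : SmoothFun n := ⟨fun z => conj (z j), contDiff_conj_coord j⟩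

/-- Complex conjugation of smooth functions. -/
def cj (F : SmoothFun n) : SmoothFun n :=
  ⟨fun z => conj ((F : Cn n → ℂ) z), Complex.conjCLE.contDiff.comp (smooth F)⟩

theorem cj_apply (F : SmoothFun n) (z : Cn n) :
    (cj F : Cn n → ℂ) z = conj ((F : Cn n → ℂ) z) := rfl

@[simp] theorem cj_cj (F : SmoothFun n) : cj (cj F) = F :=
  Subtype.ext <| funext fun z => by simp [cj_apply]

@[simp] theorem cj_mul (F G : SmoothFun n) : cj (F * G) = cj F * cj G :=
  Subtype.ext <| funext fun z => map_mul conj (F.1 z) (G.1 z)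

@[simp] theorem cj_sub (F G : SmoothFun n) : cj (F - G) = cj F - cj G :=
  Subtype.ext <| funext fun z => map_sub conj (F.1 z) (G.1 z)

@[simp] theorem cj_add (F G : SmoothFun n) : cj (F + G) = cj F + cj G :=
  Subtype.ext <| funext fun z => map_add conj (F.1 z) (G.1 z)

@[simp] theorem cj_zero : cj (0 : SmoothFun n) = 0 :=
  Subtype.ext <| funext fun _ => map_zero conj

@[simp] theorem cj_zc (j : Fin n) : cj (zc j) = zb j := rfl

@[simp] theorem cj_zb (j : Fin n) : cj (zb j) = zc j :=
  Subtype.ext <| funext fun z => by simp [cj, zc, zb]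

theorem cj_sum {ι : Type*} (s : Finset ι) (F : ι → SmoothFun n) :
    cj (∑ i ∈ s, F i) = ∑ i ∈ s, cj (F i) :=
  map_sum (AddMonoidHom.mk' (cj (n := n)) cj_add) F s

theorem cj_intCast_smul (p : ℤ) (F : SmoothFun n) : cj (p • F) = p • cj F :=
  map_zsmul (AddMonoidHom.mk' (cj (n := n)) cj_add) p F

@[simp] theorem dz_cj (k : Fin n) (F : SmoothFun n) : dz k (cj F) = cj (dzb k F) :=
  Subtype.ext <| funext fun z => by
    rw [dz_apply, cj_apply, dzb_apply]; exact (wirt_conj (F : Cn n → ℂ) z k).1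

@[simp] theorem dzb_cj (k : Fin n) (F : SmoothFun n) : dzb k (cj F) = cj (dz k F) :=
  Subtype.ext <| funext fun z => by
    rw [dzb_apply, cj_apply, dz_apply]; exact (wirt_conj (F : Cn n → ℂ) z k).2

theorem dz_zc (k j : Fin n) : dz k (zc j) = if k = j then 1 else 0 := by
  refine Subtype.ext <| funext fun z => ?_
  have hd : HasFDerivAt (fun z : Cn n => z j) (EuclideanSpace.proj (𝕜 := ℂ) (ι := Fin n) j) z :=
    (EuclideanSpace.proj (𝕜 := ℂ) (ι := Fin n) j).hasFDerivAt
  have := (wirt_of_differentiableAt hd.differentiableAt k).1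
  rw [hd.fderiv] at this
  rw [dz_apply]
  refine this.trans ?_
  split_ifs with h
  · subst h; simp
  · simp [Ne.symm h]

theorem dzb_zc (k j : Fin n) : dzb k (zc j) = 0 := by
  refine Subtype.ext <| funext fun z => ?_
  have hd : HasFDerivAt (fun z : Cn n => z j) (EuclideanSpace.proj (𝕜 := ℂ) (ι := Fin n) j) z :=
    (EuclideanSpace.proj (𝕜 := ℂ) (ι := Fin n) j).hasFDerivAt
  rw [dzb_apply]
  exact (wirt_of_differentiableAt hd.differentiableAt k).2

theorem dz_zb (k j : Fin n) : dz k (zb j) = 0 := by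
  rw [← cj_zc, dz_cj, dzb_zc, cj_zero]

theorem dzb_zb (k j : Fin n) : dzb k (zb j) = if k = j then 1 else 0 := by
  rw [← cj_zc, dzb_cj, dz_zc]
  split_ifs
  · exact Subtype.ext <| funext fun _ => map_one conj
  · exact cj_zero

/-- The Euler operator `∑ z_k ∂_k`. -/
def eul (F : SmoothFun n) : SmoothFun n := ∑ k, zc k * dz k F

/-- The conjugate Euler operator `∑ z̄_k ∂̄_k`. -/
def eulBar (F : SmoothFun n) : SmoothFun n := ∑ k, zb k * dzb k F

/-- A quarter of the Laplacian, `∑ ∂_k ∂̄_k`. -/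
def lap (F : SmoothFun n) : SmoothFun n := ∑ k, dz k (dzb k F)

/-- Membership in the space of harmonic functions homogeneous of bidegree `(p, q)`, expressed by
Euler's equations. The degrees are integers, so that the tangential fields can be applied without a
case distinction; for `n ≥ 2` and positive total degree, a negative degree forces vanishing on the
sphere (`IsBihom.sphereSq_eq_zero`). -/
structure IsBihom (p q : ℤ) (F : SmoothFun n) : Prop where
  eul : eul F = p • F
  eulBar : eulBar F = q • F
  lap : lap F = 0

theorem cj_eul (F : SmoothFun n) : cj (eul F) = eulBar (cj F) := by
  simp [eul, eulBar, cj_sum]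

theorem cj_eulBar (F : SmoothFun n) : cj (eulBar F) = eul (cj F) := by
  simp [eul, eulBar, cj_sum]

theorem cj_lap (F : SmoothFun n) : cj (lap F) = lap (cj F) := by
  simp only [lap, cj_sum, dzb_cj, dz_cj]
  exact Finset.sum_congr rfl fun k _ => by rw [dz_dzb_comm]

theorem IsBihom.cj {p q : ℤ} {F : SmoothFun n} (h : IsBihom p q F) : IsBihom q p (cj F) where
  eul := by rw [← cj_eulBar, h.eulBar, cj_intCast_smul]
  eulBar := by rw [← cj_eul, h.eul, cj_intCast_smul]
  lap := by rw [← cj_lap, h.lap, cj_zero]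

theorem eul_dz (k : Fin n) (F : SmoothFun n) : eul (dz k F) = dz k (eul F) - dz k F := by
  simp only [eul, map_sum, Derivation.leibniz, dz_zc, smul_eq_mul, Finset.sum_add_distrib,
    mul_ite, mul_one, mul_zero, Finset.sum_ite_eq, Finset.mem_univ, if_true, add_sub_cancel_right]
  exact Finset.sum_congr rfl fun j _ => by rw [dz_comm]

theorem eulBar_dz (k : Fin n) (F : SmoothFun n) : eulBar (dz k F) = dz k (eulBar F) := by
  simp only [eulBar, map_sum, Derivation.leibniz, dz_zb, smul_eq_mul, mul_zero, add_zero]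
  exact Finset.sum_congr rfl fun j _ => by rw [dz_dzb_comm]

theorem lap_dz (k : Fin n) (F : SmoothFun n) : lap (dz k F) = dz k (lap F) := by
  simp only [lap, map_sum]
  exact Finset.sum_congr rfl fun j _ => by rw [← dz_dzb_comm, dz_comm]

theorem IsBihom.dz {p q : ℤ} {F : SmoothFun n} (h : IsBihom p q F) (k : Fin n) :
    IsBihom (p - 1) q (dz k F) where
  eul := by rw [eul_dz, h.eul, map_zsmul, sub_smul, one_smul]
  eulBar := by rw [eulBar_dz, h.eulBar, map_zsmul]
  lap := by rw [lap_dz, h.lap, map_zero]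

theorem eul_zb_mul (j : Fin n) (F : SmoothFun n) : eul (zb j * F) = zb j * eul F := by
  simp only [eul, Derivation.leibniz, dz_zb, smul_eq_mul, mul_zero, add_zero, Finset.mul_sum]
  exact Finset.sum_congr rfl fun k _ => by ring

theorem eulBar_zb_mul (j : Fin n) (F : SmoothFun n) :
    eulBar (zb j * F) = zb j * eulBar F + zb j * F := by
  simp only [eulBar, Derivation.leibniz, dzb_zb, smul_eq_mul, mul_add, Finset.sum_add_distrib,
    Finset.mul_sum, mul_ite, mul_one, mul_zero, Finset.sum_ite_eq', Finset.mem_univ, if_true]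
  congr 1
  exact Finset.sum_congr rfl fun k _ => by ring

/-- Multiplication by `z̄_j` does not preserve harmonicity, but the defect `∂_j F` cancels in `z̄_j
∂_k F - z̄_k ∂_j F`. -/
theorem lap_zb_mul (j : Fin n) (F : SmoothFun n) : lap (zb j * F) = zb j * lap F + dz j F := by
  have e : ∀ k, dz k (dzb k (zb j * F)) =
      zb j * dz k (dzb k F) + if k = j then dz k F else 0 := by
    intro k
    simp only [Derivation.leibniz, dzb_zb, dz_zb, smul_eq_mul, map_add, mul_zero, add_zero]
    split_ifs <;> simp
  simp only [lap, e, Finset.sum_add_distrib, Finset.mul_sum, Finset.sum_ite_eq', Finset.mem_univ,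
    if_true]

theorem eul_sub (F G : SmoothFun n) : eul (F - G) = eul F - eul G := by
  simp [eul, mul_sub]

theorem eulBar_sub (F G : SmoothFun n) : eulBar (F - G) = eulBar F - eulBar G := by
  simp [eulBar, mul_sub]

theorem lap_sub (F G : SmoothFun n) : lap (F - G) = lap F - lap G := by
  simp [lap]

/-- The field `L_{jk}` on smooth functions; it vanishes for `j = k`. -/
def tangL (j k : Fin n) (F : SmoothFun n) : SmoothFun n := zb j * dz k F - zb k * dz j F

/-- The field `L̄_{jk}` on smooth functions; it vanishes for `j = k`. -/
def tangLBar (j k : Fin n) (F : SmoothFun n) : SmoothFun n := zc j * dzb k F - zc k * dzb j F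

theorem cj_tangL (j k : Fin n) (F : SmoothFun n) : cj (tangL j k F) = tangLBar j k (cj F) := by
  simp [tangL, tangLBar]

theorem cj_tangLBar (j k : Fin n) (F : SmoothFun n) : cj (tangLBar j k F) = tangL j k (cj F) := by
  simp [tangL, tangLBar]

theorem IsBihom.tangL {p q : ℤ} {F : SmoothFun n} (h : IsBihom p q F) (j k : Fin n) :
    IsBihom (p - 1) (q + 1) (tangL j k F) where
  eul := by
    rw [SmoothFun.tangL, eul_sub, eul_zb_mul, eul_zb_mul, (h.dz j).eul, (h.dz k).eul, smul_sub,
      mul_smul_comm, mul_smul_comm]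
  eulBar := by
    rw [SmoothFun.tangL, eulBar_sub, eulBar_zb_mul, eulBar_zb_mul, (h.dz j).eulBar,
      (h.dz k).eulBar, smul_sub, mul_smul_comm, mul_smul_comm, add_smul, add_smul, one_smul,
      one_smul]
  lap := by
    rw [SmoothFun.tangL, lap_sub, lap_zb_mul, lap_zb_mul, (h.dz j).lap, (h.dz k).lap, mul_zero,
      mul_zero, zero_add, zero_add, dz_comm, sub_self]

theorem IsBihom.tangLBar {p q : ℤ} {F : SmoothFun n} (h : IsBihom p q F) (j k : Fin n) :
    IsBihom (p + 1) (q - 1) (tangLBar j k F) := by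
  have := (h.cj.tangL j k).cj
  rwa [cj_tangL, cj_cj] at this

theorem tangLBar_sub (j k : Fin n) (F G : SmoothFun n) :
    tangLBar j k (F - G) = tangLBar j k F - tangLBar j k G := by
  simp only [tangLBar, map_sub]; ring

theorem tangLBar_mul (j k : Fin n) (F G : SmoothFun n) :
    tangLBar j k (F * G) = tangLBar j k F * G + F * tangLBar j k G := by
  simp only [tangLBar, Derivation.leibniz, smul_eq_mul]; ring

/-- The fields `L̄_{jk} L_{jk}` add up to a Casimir operator, which is a scalar on each space of
harmonic bihomogeneous functions. -/
theorem IsBihom.sum_tangLBar_tangL {p q : ℤ} {F : SmoothFun n} (h : IsBihom p q F) :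
    ∑ j, ∑ k, SmoothFun.tangLBar j k (SmoothFun.tangL j k F) =
      (-(2 * p * (q + n - 1)) : ℤ) • F := by
  -- The second-order terms either contain the Laplacian or reduce to Euler operators.
  have key : ∑ j, ∑ k, SmoothFun.tangLBar j k (zb j * SmoothFun.dz k F) =
      (-(p * (q + n - 1)) : ℤ) • F := by
    have e : ∀ j k, SmoothFun.tangLBar j k (zb j * SmoothFun.dz k F) =
        (if k = j then zc j * SmoothFun.dz k F else 0) +
          zc j * zb j * SmoothFun.dz k (dzb k F) - zc k * SmoothFun.dz k F -
          zc k * (zb j * dzb j (SmoothFun.dz k F)) := by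
      intro j k
      simp only [SmoothFun.tangLBar, Derivation.leibniz, dzb_zb, smul_eq_mul, dz_dzb_comm, if_true]
      split_ifs <;> ring
    simp only [e, Finset.sum_sub_distrib, Finset.sum_add_distrib, Finset.sum_ite_eq',
      Finset.mem_univ, if_true]
    have h1 : ∑ j, ∑ k, zc j * zb j * SmoothFun.dz k (dzb k F) = 0 := by
      refine Finset.sum_eq_zero fun j _ => ?_
      rw [← Finset.mul_sum]
      exact (congrArg _ h.lap).trans (mul_zero _)
    have h2 : ∑ j : Fin n, zc j * SmoothFun.dz j F = p • F := h.eul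
    have h3 : ∑ j : Fin n, ∑ k, zc k * (zb j * dzb j (SmoothFun.dz k F)) = (q * p) • F := by
      rw [Finset.sum_comm]
      have : ∀ k, ∑ j, zc k * (zb j * dzb j (SmoothFun.dz k F)) =
          q • (zc k * SmoothFun.dz k F) := by
        intro k
        rw [← Finset.mul_sum]
        exact (congrArg _ (h.dz k).eulBar).trans (mul_smul_comm _ _ _)
      simp only [this]
      rw [← Finset.smul_sum, h2, mul_smul]
    rw [h1, h2, h3, Finset.sum_const, Finset.card_univ, Fintype.card_fin]
    module
  -- By antisymmetry both halves of `L_{jk}` contribute the same sum.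
  have e : ∀ j k, SmoothFun.tangLBar j k (SmoothFun.tangL j k F) =
      SmoothFun.tangLBar j k (zb j * SmoothFun.dz k F) +
        SmoothFun.tangLBar k j (zb k * SmoothFun.dz j F) := by
    intro j k
    rw [SmoothFun.tangL, tangLBar_sub]
    simp only [SmoothFun.tangLBar]
    ring
  simp only [e, Finset.sum_add_distrib]
  rw [Finset.sum_comm (f := fun j k => SmoothFun.tangLBar k j (zb k * SmoothFun.dz j F)), key]
  module

end SmoothFun

/-! ### Norms of tangential derivatives of harmonic bihomogeneous functions -/

namespace SmoothFun

/-- Integration over the unit sphere. -/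
def sphereInt : SmoothFun n →ₗ[ℂ] ℂ where
  toFun F := ∫ ζ : sphere (0 : Cn n) 1, (F : Cn n → ℂ) ζ ∂sphereMeasure n
  map_add' F G := integral_add (integrable_sphere (smooth F).continuous)
    (integrable_sphere (smooth G).continuous)
  map_smul' c _ := integral_const_mul c _

/-- The squared `L²` norm over the unit sphere, as a real number. -/
def sphereSq (F : SmoothFun n) : ℝ :=
  ∫ ζ : sphere (0 : Cn n) 1, ‖(F : Cn n → ℂ) ζ‖ ^ 2 ∂sphereMeasure n

theorem sphereSq_nonneg (F : SmoothFun n) : 0 ≤ sphereSq F :=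
  integral_nonneg fun _ => by positivity

theorem ofReal_sphereSq (F : SmoothFun n) : (sphereSq F : ℂ) = sphereInt (F * cj F) := by
  refine (integral_ofReal (𝕜 := ℂ)).symm.trans ?_
  refine integral_congr_ae (Filter.Eventually.of_forall fun ζ => ?_)
  change ((‖(F : Cn n → ℂ) ζ‖ ^ 2 : ℝ) : ℂ) = (F : Cn n → ℂ) ζ * conj ((F : Cn n → ℂ) ζ)
  rw [Complex.mul_conj']
  push_cast
  rfl

theorem sphereNormSq_eq (F : SmoothFun n) :
    sphereNormSq (F : Cn n → ℂ) = ENNReal.ofReal (sphereSq F) := by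
  have hc : Continuous fun z : Cn n => ‖(F : Cn n → ℂ) z‖ ^ 2 :=
    (smooth F).continuous.norm.pow 2
  have hi : Integrable (fun ζ : sphere (0 : Cn n) 1 => ‖(F : Cn n → ℂ) ζ‖ ^ 2)
      (sphereMeasure n) :=
    (hc.comp continuous_subtype_val).integrable_of_hasCompactSupport
      (HasCompactSupport.of_compactSpace _)
  rw [sphereSq, ofReal_integral_eq_lintegral_ofReal hi
    (Filter.Eventually.of_forall fun _ => by positivity), sphereNormSq]
  refine lintegral_congr fun ζ => ?_
  rw [← ofReal_norm, ENNReal.ofReal_pow (norm_nonneg _)]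

theorem sphereSq_cj (F : SmoothFun n) : sphereSq (cj F) = sphereSq F := by
  simp [sphereSq, cj_apply]

/-- A tangential field acting on smooth functions. -/
def tangA (i : TangIdx n) (F : SmoothFun n) : SmoothFun n :=
  ⟨tang i F, contDiffOn_univ.1 (contDiffOn_tang isOpen_univ (smooth F).contDiffOn i)⟩

/-- A composition of tangential fields acting on smooth functions. -/
def tangIterA {m : ℕ} (J : Fin m → TangIdx n) (F : SmoothFun n) : SmoothFun n :=
  ⟨tangIter J F, contDiffOn_univ.1 (contDiffOn_tangIter isOpen_univ (smooth F).contDiffOn J)⟩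

theorem tangIterA_zero (J : Fin 0 → TangIdx n) (F : SmoothFun n) : tangIterA J F = F :=
  Subtype.ext (tangIter_zero J F)

theorem tangIterA_cons {m : ℕ} (i : TangIdx n) (J : Fin m → TangIdx n) (F : SmoothFun n) :
    tangIterA (Fin.cons i J : Fin (m + 1) → TangIdx n) F = tangA i (tangIterA J F) :=
  Subtype.ext (tangIter_cons i J F)

theorem tangA_false (p : {p : Fin n × Fin n // p.1 ≠ p.2}) (F : SmoothFun n) :
    tangA (p, false) F = tangL p.1.1 p.1.2 F :=
  Subtype.ext <| funext fun z => by
    change tang (p, false) F z = conj (z p.1.1) * (dz p.1.2 F : Cn n → ℂ) z -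
      conj (z p.1.2) * (dz p.1.1 F : Cn n → ℂ) z
    rw [dz_apply, dz_apply, tang]

theorem tangA_true (p : {p : Fin n × Fin n // p.1 ≠ p.2}) (F : SmoothFun n) :
    tangA (p, true) F = tangLBar p.1.1 p.1.2 F :=
  Subtype.ext <| funext fun z => by
    change tang (p, true) F z = z p.1.1 * (dzb p.1.2 F : Cn n → ℂ) z -
      z p.1.2 * (dzb p.1.1 F : Cn n → ℂ) z
    rw [dzb_apply, dzb_apply, tang]

theorem sphereInt_tangLBar (j k : Fin n) (F : SmoothFun n) : sphereInt (tangLBar j k F) = 0 := by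
  by_cases h : j = k
  · subst h
    simp [tangLBar]
  · rw [← tangA_true ⟨(j, k), h⟩]
    exact integral_tang_eq_zero (smooth F) (⟨(j, k), h⟩, true)

/-- Integration by parts turns the sum of squared norms into the Casimir operator `∑ L̄_{jk} L_{jk}`
paired with `F`. -/
theorem IsBihom.sum_sphereSq_tangL {p q : ℤ} {F : SmoothFun n} (h : IsBihom p q F) :
    ∑ j, ∑ k, sphereSq (SmoothFun.tangL j k F) = 2 * p * (q + n - 1) * sphereSq F := by
  have e : ∀ j k, (sphereSq (SmoothFun.tangL j k F) : ℂ) =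
      -sphereInt (SmoothFun.tangLBar j k (SmoothFun.tangL j k F) * SmoothFun.cj F) := by
    intro j k
    have h0 := sphereInt_tangLBar j k (SmoothFun.tangL j k F * SmoothFun.cj F)
    rw [tangLBar_mul, map_add, ← cj_tangL, ← ofReal_sphereSq] at h0
    linear_combination h0
  apply Complex.ofReal_injective
  push_cast
  simp only [e, Finset.sum_neg_distrib, ← map_sum, ← Finset.sum_mul]
  rw [h.sum_tangLBar_tangL, smul_mul_assoc, map_zsmul, ← ofReal_sphereSq, zsmul_eq_mul]
  push_cast
  ring

theorem IsBihom.sum_sphereSq_tangLBar {p q : ℤ} {F : SmoothFun n} (h : IsBihom p q F) :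
    ∑ j, ∑ k, sphereSq (SmoothFun.tangLBar j k F) = 2 * q * (p + n - 1) * sphereSq F := by
  have := h.cj.sum_sphereSq_tangL
  simpa only [← cj_tangLBar, sphereSq_cj] using this

theorem sum_offDiag (f : Fin n → Fin n → ℝ) (h : ∀ j, f j j = 0) :
    ∑ p : {p : Fin n × Fin n // p.1 ≠ p.2}, f p.1.1 p.1.2 = ∑ j, ∑ k, f j k := by
  rw [← Fintype.sum_prod_type', ← Finset.sum_filter_add_sum_filter_not Finset.univ
    (fun p : Fin n × Fin n => p.1 ≠ p.2)]
  rw [Finset.sum_eq_zero (s := Finset.univ.filter fun p : Fin n × Fin n => ¬ p.1 ≠ p.2), add_zero]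
  · exact (Finset.sum_subtype _ (by simp) fun p : Fin n × Fin n => f p.1 p.2).symm
  · rintro ⟨j, k⟩ hp
    simp only [Finset.mem_filter, not_not] at hp
    rw [hp.2, h]

theorem IsBihom.sum_sphereSq_tangA {p q : ℤ} {F : SmoothFun n} (h : IsBihom p q F) :
    ∑ i, sphereSq (tangA i F) = (4 * p * q + 2 * (n - 1) * (p + q)) * sphereSq F := by
  rw [Fintype.sum_prod_type]
  simp only [Fintype.sum_bool, tangA_false, tangA_true, Finset.sum_add_distrib]
  have h0 : sphereSq (0 : SmoothFun n) = 0 := by simp [sphereSq]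
  rw [sum_offDiag fun j k => sphereSq (SmoothFun.tangLBar j k F),
    sum_offDiag fun j k => sphereSq (SmoothFun.tangL j k F), h.sum_sphereSq_tangL,
    h.sum_sphereSq_tangLBar]
  · ring
  · simp [SmoothFun.tangL, h0]
  · simp [SmoothFun.tangLBar, h0]

/-- Harmonic functions of positive total degree vanish if one of the two degrees is negative,
since the squared norms of their derivatives add up to a negative multiple of their own. -/
theorem IsBihom.sphereSq_eq_zero (hn : 2 ≤ n) {p q : ℤ} {F : SmoothFun n} (h : IsBihom p q F)
    (hm : 1 ≤ p + q) (hpq : p < 0 ∨ q < 0) : sphereSq F = 0 := by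
  have h1 : 0 ≤ 2 * (p : ℝ) * (q + n - 1) * sphereSq F := h.sum_sphereSq_tangL ▸
    Finset.sum_nonneg fun _ _ => Finset.sum_nonneg fun _ _ => sphereSq_nonneg _
  have h2 : 0 ≤ 2 * (q : ℝ) * (p + n - 1) * sphereSq F := h.sum_sphereSq_tangLBar ▸
    Finset.sum_nonneg fun _ _ => Finset.sum_nonneg fun _ _ => sphereSq_nonneg _
  have hm' : (1 : ℝ) ≤ p + q := by exact_mod_cast hm
  have hn' : (2 : ℝ) ≤ n := by exact_mod_cast hn
  have h0 := sphereSq_nonneg F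
  rcases hpq with hp | hq
  · have hp' : (p : ℝ) < 0 := by exact_mod_cast hp
    have : 2 * (p : ℝ) * (q + n - 1) < 0 :=
      mul_neg_of_neg_of_pos (by linarith) (by linarith)
    nlinarith
  · have hq' : (q : ℝ) < 0 := by exact_mod_cast hq
    have : 2 * (q : ℝ) * (p + n - 1) < 0 :=
      mul_neg_of_neg_of_pos (by linarith) (by linarith)
    nlinarith

theorem IsBihom.tangA {p q : ℤ} {F : SmoothFun n} (h : IsBihom p q F) (i : TangIdx n) :
    IsBihom (p - 1) (q + 1) (tangA i F) ∨ IsBihom (p + 1) (q - 1) (tangA i F) := by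
  rcases i with ⟨p, _ | _⟩
  · exact Or.inl (tangA_false p F ▸ h.tangL _ _)
  · exact Or.inr (tangA_true p F ▸ h.tangLBar _ _)

/-- A composition of `k` tangential fields moves the bidegree by at most `k` and keeps the total
degree. -/
theorem IsBihom.tangIterA {p q : ℤ} {F : SmoothFun n} (h : IsBihom p q F) {k : ℕ}
    (J : Fin k → TangIdx n) :
    ∃ s : ℤ, |s| ≤ k ∧ IsBihom (p - s) (q + s) (tangIterA J F) := by
  induction k, J using tangIdx_induction with
  | zero J => exact ⟨0, by simp, by simpa [tangIterA_zero] using h⟩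
  | cons m i J ih =>
    obtain ⟨s, hs, hb⟩ := ih
    rw [tangIterA_cons]
    rcases hb.tangA i with h | h
    · refine ⟨s + 1, ?_, ?_⟩
      · rw [abs_le] at hs ⊢; push_cast; omega
      · convert h using 1 <;> ring
    · refine ⟨s - 1, ?_, ?_⟩
      · rw [abs_le] at hs ⊢; push_cast; omega
      · convert h using 1 <;> ring

/-- The constant in the upper bound for iterated tangential derivatives: the product of the factors
in `IsBihom.sum_sphereSq_tangA_bounds` over the successive steps. -/
def tangConst (n : ℕ) : ℕ → ℝ
  | 0 => 1
  | k + 1 => (4 * k * (k + 1) + 2 * n) * tangConst n k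

theorem tangConst_pos (hn : 2 ≤ n) (k : ℕ) : 0 < tangConst n k := by
  induction k with
  | zero => exact one_pos
  | succ k ih =>
    have : (2 : ℝ) ≤ n := by exact_mod_cast hn
    rw [tangConst]
    positivity

/-- The eigenvalue of the sum of the squares of the tangential fields is comparable to the total
degree near the two extreme bidegrees. -/
theorem IsBihom.sum_sphereSq_tangA_bounds (hn : 2 ≤ n) {m k : ℕ} (hm : 1 ≤ m) {p q : ℤ}
    {F : SmoothFun n} (h : IsBihom p q F) (hpq : p + q = m) (hk : |p| ≤ k ∨ |q| ≤ k) :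
    m * sphereSq F ≤ ∑ i, sphereSq (SmoothFun.tangA i F) ∧
      ∑ i, sphereSq (SmoothFun.tangA i F) ≤ (4 * k * (k + 1) + 2 * n) * m * sphereSq F := by
  rw [h.sum_sphereSq_tangA]
  by_cases hneg : p < 0 ∨ q < 0
  · simp [h.sphereSq_eq_zero hn (by omega) hneg]
  · push Not at hneg
    have hp : (0 : ℝ) ≤ p := by exact_mod_cast hneg.1
    have hq : (0 : ℝ) ≤ q := by exact_mod_cast hneg.2
    have hm' : (1 : ℝ) ≤ m := by exact_mod_cast hm
    have hn' : (2 : ℝ) ≤ n := by exact_mod_cast hn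
    have hs : (p : ℝ) + q = m := by exact_mod_cast hpq
    have hk0 : (0 : ℝ) ≤ k := k.cast_nonneg
    -- One degree is at most `k`, the other at most `m`.
    have hle : (p : ℝ) * q ≤ k * m := by
      rcases hk with hk | hk
      · have : (p : ℝ) ≤ k := by exact_mod_cast (le_abs_self p).trans hk
        nlinarith
      · have : (q : ℝ) ≤ k := by exact_mod_cast (le_abs_self q).trans hk
        nlinarith
    rw [hs]
    constructor <;> refine mul_le_mul_of_nonneg_right ?_ (sphereSq_nonneg F)
    · nlinarith [mul_nonneg hp hq]
    · nlinarith [mul_nonneg hk0 (mul_nonneg hk0 (zero_le_one.trans hm'))]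

/-- The squared norms of all `k`-fold tangential derivatives of a harmonic function of bidegree
`(m, 0)` or `(0, m)` add up to `m ^ k` times its own, up to a constant. -/
theorem IsBihom.sum_sphereSq_tangIterA_bounds (hn : 2 ≤ n) {m : ℕ} (hm : 1 ≤ m) {p q : ℤ}
    {F : SmoothFun n} (h : IsBihom p q F) (hpq : p + q = m) (h0 : p = 0 ∨ q = 0) (k : ℕ) :
    m ^ k * sphereSq F ≤ ∑ J : Fin k → TangIdx n, sphereSq (SmoothFun.tangIterA J F) ∧
      ∑ J : Fin k → TangIdx n, sphereSq (SmoothFun.tangIterA J F) ≤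
        tangConst n k * m ^ k * sphereSq F := by
  induction k with
  | zero => simp [tangIterA_zero, tangConst]
  | succ k ih =>
    have e : ∑ J : Fin (k + 1) → TangIdx n, sphereSq (SmoothFun.tangIterA J F) =
        ∑ J : Fin k → TangIdx n, ∑ i, sphereSq (SmoothFun.tangA i (SmoothFun.tangIterA J F)) := by
      rw [← (Fin.consEquiv fun _ : Fin (k + 1) => TangIdx n).sum_comp, Fintype.sum_prod_type,
        Finset.sum_comm]
      refine Finset.sum_congr rfl fun J _ => Finset.sum_congr rfl fun i _ => ?_
      rw [← tangIterA_cons]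
      rfl
    have hJ : ∀ J : Fin k → TangIdx n,
        m * sphereSq (SmoothFun.tangIterA J F) ≤
            ∑ i, sphereSq (SmoothFun.tangA i (SmoothFun.tangIterA J F)) ∧
          ∑ i, sphereSq (SmoothFun.tangA i (SmoothFun.tangIterA J F)) ≤
            (4 * k * (k + 1) + 2 * n) * m * sphereSq (SmoothFun.tangIterA J F) := fun J => by
      obtain ⟨s, hs, hb⟩ := h.tangIterA J
      exact hb.sum_sphereSq_tangA_bounds hn hm (k := k) (by omega) (by
        rcases h0 with rfl | rfl
        · left; simpa using hs
        · right; simpa using hs)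
    have hm0 : (0 : ℝ) ≤ m := m.cast_nonneg
    rw [e]
    constructor
    · calc (m : ℝ) ^ (k + 1) * sphereSq F = m * (m ^ k * sphereSq F) := by ring
        _ ≤ m * ∑ J : Fin k → TangIdx n, sphereSq (SmoothFun.tangIterA J F) := by
          gcongr; exact ih.1
        _ ≤ _ := by
          rw [Finset.mul_sum]
          exact Finset.sum_le_sum fun J _ => (hJ J).1
    · calc _ ≤ ∑ J : Fin k → TangIdx n, (4 * k * (k + 1) + 2 * n) * m *
            sphereSq (SmoothFun.tangIterA J F) := Finset.sum_le_sum fun J _ => (hJ J).2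
        _ ≤ (4 * k * (k + 1) + 2 * n) * m * (tangConst n k * m ^ k * sphereSq F) := by
          rw [← Finset.mul_sum]
          gcongr
          exact ih.2
        _ = _ := by rw [tangConst]; ring

end SmoothFun

/-- A homogeneous component of a holomorphic function, as a smooth function. -/
def homCompA {g : Cn n → ℂ} (hg : IsHolomorphic g) (m : ℕ) : SmoothFun n :=
  ⟨homComp g m, (contDiff_homComp hg m).restrict_scalars ℝ⟩

/-- By Euler's relation the component of degree `m` has bidegree `(m, 0)`; it is harmonic since it
is holomorphic. -/
theorem isBihom_homCompA {g : Cn n → ℂ} (hg : IsHolomorphic g) (m : ℕ) :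
    SmoothFun.IsBihom m 0 (homCompA hg m) := by
  have hd : Differentiable ℂ (homComp g m) := (contDiff_homComp hg m).differentiable (by simp)
  have hzb : ∀ k, SmoothFun.dzb k (homCompA hg m) = 0 := fun k =>
    Subtype.ext <| funext fun z => by
      rw [SmoothFun.dzb_apply]
      exact (wirt_of_differentiableAt (hd z) k).2
  refine ⟨Subtype.ext <| funext fun z => ?_, by simp [SmoothFun.eulBar, hzb],
    by simp [SmoothFun.lap, hzb]⟩
  have h1 : (SmoothFun.eul (homCompA hg m) : Cn n → ℂ) z =
      ∑ k, z k * wirt k (homComp g m) z := by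
    simp only [SmoothFun.eul, AddSubmonoidClass.coe_finsetSum, Finset.sum_apply]
    refine Finset.sum_congr rfl fun k _ => ?_
    change z k * (SmoothFun.dz k (homCompA hg m) : Cn n → ℂ) z = _
    rw [SmoothFun.dz_apply]
    rfl
  have h2 := fderiv_eq_sum_wirt (homComp g m) z z
  have h3 : fderiv ℝ (homComp g m) z = (fderiv ℂ (homComp g m) z).restrictScalars ℝ :=
    ((hd z).hasFDerivAt.restrictScalars ℝ).fderiv
  simp only [(wirt_of_differentiableAt (hd z) _).2, mul_zero, add_zero] at h2
  rw [h1, ← h2, h3, ContinuousLinearMap.coe_restrictScalars', fderiv_homComp_self hg]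
  change _ = ((m : ℤ) • homComp g m z : ℂ)
  simp

/-! ### Fourier analysis along the circle action -/

theorem integrable_fourier_smul {u : Torus → ℂ} (hu : Continuous u) (l : ℤ) :
    Integrable (fun t : Torus => fourier (-l) t • u t) AddCircle.haarAddCircle :=
  ((fourier (-l)).continuous.smul hu).integrable_of_hasCompactSupport
    (HasCompactSupport.of_compactSpace _)

theorem fourierCoeff_lincomb {u v : Torus → ℂ} (hu : Continuous u) (hv : Continuous v) (a b : ℂ)
    (l : ℤ) : fourierCoeff (fun t => a * u t + b * v t) l =
      a * fourierCoeff u l + b * fourierCoeff v l := by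
  simp only [fourierCoeff]
  rw [← integral_const_mul, ← integral_const_mul, ← integral_add
    ((integrable_fourier_smul hu l).const_mul a)
    ((integrable_fourier_smul hv l).const_mul b)]
  refine integral_congr_ae (Filter.Eventually.of_forall fun t => ?_)
  simp only [smul_eq_mul]
  ring

theorem rot_ne_zero (t : Torus) : rot t ≠ 0 := Circle.coe_ne_zero _

theorem conj_rot (t : Torus) : conj (rot t) = (rot t)⁻¹ := by
  rw [rot, ← Circle.coe_inv_eq_conj, Circle.coe_inv]

/-- Multiplication by a character shifts the Fourier coefficients. -/
theorem fourierCoeff_rot_zpow_mul (u : Torus → ℂ) (s l : ℤ) :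
    fourierCoeff (fun t => rot t ^ s * u t) l = fourierCoeff u (l - s) := by
  refine integral_congr_ae (Filter.Eventually.of_forall fun t => ?_)
  simp only [smul_eq_mul, fourier_eq_rot_zpow]
  rw [← mul_assoc, ← zpow_add₀ (rot_ne_zero t)]
  congr 2
  ring

theorem fourierCoeff_conj (u : Torus → ℂ) (l : ℤ) :
    fourierCoeff (fun t => conj (u t)) l = conj (fourierCoeff u (-l)) := by
  rw [fourierCoeff, fourierCoeff, ← integral_conj]
  refine integral_congr_ae (Filter.Eventually.of_forall fun t => ?_)
  simp only [smul_eq_mul, fourier_eq_rot_zpow, map_mul, map_zpow₀, conj_rot, inv_zpow', neg_neg]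

/-- **Parseval's identity** on the circle in `ℝ≥0∞`. -/
theorem tsum_enorm_sq_fourierCoeff {u : Torus → ℂ} (hu : Continuous u) :
    ∑' l, ‖fourierCoeff u l‖ₑ ^ 2 = ∫⁻ t, ‖u t‖ₑ ^ 2 ∂AddCircle.haarAddCircle := by
  set U : C(Torus, ℂ) := ⟨u, hu⟩ with hU
  have h := hasSum_sq_fourierCoeff (ContinuousMap.toLp (E := ℂ) 2 AddCircle.haarAddCircle ℂ U)
  simp only [fourierCoeff_toLp] at h
  have h2 : ∫ t : Torus, ‖ContinuousMap.toLp (E := ℂ) 2 AddCircle.haarAddCircle ℂ U t‖ ^ 2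
      ∂AddCircle.haarAddCircle = ∫ t, ‖u t‖ ^ 2 ∂AddCircle.haarAddCircle := by
    refine integral_congr_ae ?_
    filter_upwards [ContinuousMap.coeFn_toLp (p := 2) (𝕜 := ℂ) AddCircle.haarAddCircle U] with t ht
    rw [ht]
    rfl
  rw [h2] at h
  have hi : Integrable (fun t => ‖u t‖ ^ 2) (AddCircle.haarAddCircle (T := 2 * Real.pi)) :=
    (hu.norm.pow 2).integrable_of_hasCompactSupport (HasCompactSupport.of_compactSpace _)
  have e : ∀ x : ℂ, ‖x‖ₑ ^ 2 = ENNReal.ofReal (‖x‖ ^ 2) := fun x => by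
    rw [← ofReal_norm, ENNReal.ofReal_pow (norm_nonneg _)]
  simp only [e]
  rw [← ofReal_integral_eq_lintegral_ofReal hi (Filter.Eventually.of_forall fun _ => by positivity),
    ← h.tsum_eq, ENNReal.ofReal_tsum_of_nonneg (fun _ => by positivity) h.summable]
  rfl

/-- The component of `F` of weight `l` under the circle action `F ↦ F (e^{iθ} ·)`. -/
def rotCoeff (l : ℤ) (F : Cn n → ℂ) (z : Cn n) : ℂ :=
  fourierCoeff (fun t : Torus => F (rot t • z)) l

theorem rotCoeff_sub (l s : ℤ) (F : Cn n → ℂ) (z : Cn n) :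
    rotCoeff (l - s) F z = fourierCoeff (fun t : Torus => rot t ^ s * F (rot t • z)) l :=
  (fourierCoeff_rot_zpow_mul _ s l).symm

theorem rot_smul_mem {z : Cn n} (hz : z ∈ unitBall n) (t : Torus) : rot t • z ∈ unitBall n := by
  simpa [unitBall, norm_smul] using hz

theorem continuousOn_rot_smul {F : Cn n → ℂ} (hF : ContinuousOn F (unitBall n)) :
    ContinuousOn (fun p : Cn n × Torus => F (rot p.2 • p.1)) (unitBall n ×ˢ univ) :=
  hF.comp ((continuous_rot.comp continuous_snd).smul continuous_fst).continuousOn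
    fun _ hp => rot_smul_mem hp.1 _

theorem continuous_rot_smul {F : Cn n → ℂ} (hF : ContinuousOn F (unitBall n)) {z : Cn n}
    (hz : z ∈ unitBall n) : Continuous fun t : Torus => F (rot t • z) :=
  hF.comp_continuous (continuous_rot.smul continuous_const) fun t => rot_smul_mem hz t

theorem continuousOn_rotCoeff {F : Cn n → ℂ} (hF : ContinuousOn F (unitBall n)) (l : ℤ) :
    ContinuousOn (rotCoeff l F) (unitBall n) :=
  continuousOn_integral_of_compactSpace isOpen_unitBall
    (((fourier (-l)).continuous.comp continuous_snd).continuousOn.smul (continuousOn_rot_smul hF))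

/-- Differentiation under the integral defining the components of the circle action. -/
theorem fderiv_rotCoeff {F : Cn n → ℂ} (hF : ContDiffOn ℝ (⊤ : ℕ∞) F (unitBall n)) (l : ℤ)
    {z : Cn n} (hz : z ∈ unitBall n) (v : Cn n) :
    fderiv ℝ (rotCoeff l F) z v =
      fourierCoeff (fun t : Torus => fderiv ℝ F (rot t • z) (rot t • v)) l := by
  let M : Torus → Cn n →L[ℝ] Cn n := fun t => rot t • ContinuousLinearMap.id ℝ (Cn n)
  have hM : Continuous M := continuous_rot.smul continuous_const
  have hd : ∀ z ∈ unitBall n, ∀ t : Torus, HasFDerivAt (fun z => fourier (-l) t • F (rot t • z))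
      ((fourier (-l) t : ℂ) • (fderiv ℝ F (rot t • z)).comp (M t)) z := by
    intro z hz t
    have h1 := (differentiableAt_of_contDiffOn isOpen_unitBall hF (rot_smul_mem hz t)).hasFDerivAt
    have h2 : HasFDerivAt (fun z : Cn n => F (rot t • z)) ((fderiv ℝ F (rot t • z)).comp (M t)) z :=
      h1.comp z (M t).hasFDerivAt
    exact h2.const_smul (fourier (-l) t : ℂ)
  have hfd : ContinuousOn (fun p : Cn n × Torus => fderiv ℝ F (rot p.2 • p.1))
      (unitBall n ×ˢ univ) :=
    (hF.continuousOn_fderiv_of_isOpen isOpen_unitBall (by simp)).comp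
      ((continuous_rot.comp continuous_snd).smul continuous_fst).continuousOn
      fun _ hp => rot_smul_mem hp.1 _
  have hc' : ContinuousOn (fun p : Cn n × Torus =>
      (fourier (-l) p.2 : ℂ) • (fderiv ℝ F (rot p.2 • p.1)).comp (M p.2)) (unitBall n ×ˢ univ) :=
    ((fourier (-l)).continuous.comp continuous_snd).continuousOn.smul
      (hfd.clm_comp (hM.comp continuous_snd).continuousOn)
  have h := hasFDerivAt_integral_of_continuousOn (μ := AddCircle.haarAddCircle) isOpen_unitBall hd
    hc' (fun z hz => (fourier (-l)).continuous.smul (continuous_rot_smul hF.continuousOn hz)) hz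
  have hint : Integrable (fun t : Torus =>
      (fourier (-l) t : ℂ) • (fderiv ℝ F (rot t • z)).comp (M t)) AddCircle.haarAddCircle := by
    refine Continuous.integrable_of_hasCompactSupport ?_ (HasCompactSupport.of_compactSpace _)
    rw [← continuousOn_univ]
    exact hc'.comp (f := fun t : Torus => (z, t)) (by fun_prop) (fun _ _ => ⟨hz, trivial⟩)
  have h1 := ContinuousLinearMap.integral_apply hint v
  have h2 : fderiv ℝ (rotCoeff l F) z = _ := h.fderiv
  rw [h2, h1]
  rfl

/-- The Wirtinger derivatives shift the weight by one, in opposite directions, because the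
derivative of `z ↦ F (e^{iθ} z)` along `v` involves `e^{iθ} v`. -/
theorem wirt_rotCoeff {F : Cn n → ℂ} (hF : ContDiffOn ℝ (⊤ : ℕ∞) F (unitBall n)) (l : ℤ)
    (k : Fin n) {z : Cn n} (hz : z ∈ unitBall n) :
    wirt k (rotCoeff l F) z = rotCoeff (l - 1) (wirt k F) z ∧
      wirtBar k (rotCoeff l F) z = rotCoeff (l + 1) (wirtBar k F) z := by
  have hw := contDiffOn_wirt isOpen_unitBall hF k
  have c1 : Continuous fun t => rot t ^ (1 : ℤ) * wirt k F (rot t • z) := by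
    simpa [Pi.mul_def] using continuous_rot.mul (continuous_rot_smul hw.1.continuousOn hz)
  have c2 : Continuous fun t => rot t ^ (-1 : ℤ) * wirtBar k F (rot t • z) := by
    simpa [← conj_rot, Pi.mul_def] using (Complex.continuous_conj.comp continuous_rot).mul
      (continuous_rot_smul hw.2.continuousOn hz)
  have key : ∀ a : ℂ, fderiv ℝ (rotCoeff l F) z (EuclideanSpace.single k a) =
      a * rotCoeff (l - 1) (wirt k F) z + conj a * rotCoeff (l + 1) (wirtBar k F) z := by
    intro a
    rw [fderiv_rotCoeff hF l hz, ← sub_neg_eq_add l 1, rotCoeff_sub, rotCoeff_sub,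
      ← fourierCoeff_lincomb c1 c2]
    congr 1
    funext t
    have : rot t • (EuclideanSpace.single k a : Cn n) = EuclideanSpace.single k (rot t * a) := by
      ext i
      rcases eq_or_ne i k with rfl | h
      · simp
      · simp [h]
    rw [this, fderiv_single, map_mul, conj_rot, zpow_one, zpow_neg_one]
    ring
  simp only [wirt, wirtBar, key, map_one, Complex.conj_I]
  constructor
  · linear_combination (-(rotCoeff (l - 1) (wirt k F) z) / 2 +
      (rotCoeff (l + 1) (wirtBar k F) z) / 2) * Complex.I_sq
  · linear_combination ((rotCoeff (l - 1) (wirt k F) z) / 2 -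
      (rotCoeff (l + 1) (wirtBar k F) z) / 2) * Complex.I_sq

/-- The amount by which a tangential field shifts the weight under the circle action: one from the
derivative and one from the coordinate in front of it. -/
def tangWeight : TangIdx n → ℤ
  | (_, false) => -2
  | (_, true) => 2

theorem tang_rotCoeff {F : Cn n → ℂ} (hF : ContDiffOn ℝ (⊤ : ℕ∞) F (unitBall n)) (l : ℤ)
    (i : TangIdx n) {z : Cn n} (hz : z ∈ unitBall n) :
    tang i (rotCoeff l F) z = rotCoeff (l + tangWeight i) (tang i F) z := by
  have hw := fun k => contDiffOn_wirt isOpen_unitBall hF k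
  rcases i with ⟨p, _ | _⟩
  · have e : (fun t : Torus => rot t ^ (1 : ℤ) * tang (p, false) F (rot t • z)) =
        fun t => conj (z p.1.1) * wirt p.1.2 F (rot t • z) +
          -conj (z p.1.2) * wirt p.1.1 F (rot t • z) := by
      funext t
      have := rot_ne_zero t
      simp only [tang, PiLp.smul_apply, smul_eq_mul, map_mul, conj_rot]
      field_simp
      ring
    rw [tang, (wirt_rotCoeff hF l _ hz).1, (wirt_rotCoeff hF l _ hz).1,
      show l + tangWeight (p, false) = l - 1 - 1 by simp only [tangWeight]; ring,
      rotCoeff_sub (l - 1), e, fourierCoeff_lincomb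
        (continuous_rot_smul (hw _).1.continuousOn hz)
        (continuous_rot_smul (hw _).1.continuousOn hz), rotCoeff, rotCoeff]
    ring
  · have e : (fun t : Torus => rot t ^ (-1 : ℤ) * tang (p, true) F (rot t • z)) =
        fun t => z p.1.1 * wirtBar p.1.2 F (rot t • z) +
          -z p.1.2 * wirtBar p.1.1 F (rot t • z) := by
      funext t
      have := rot_ne_zero t
      simp only [tang, PiLp.smul_apply, smul_eq_mul, zpow_neg_one]
      field_simp
      ring
    rw [tang, (wirt_rotCoeff hF l _ hz).2, (wirt_rotCoeff hF l _ hz).2,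
      show l + tangWeight (p, true) = l + 1 - (-1) by simp only [tangWeight]; ring,
      rotCoeff_sub (l + 1), e, fourierCoeff_lincomb
        (continuous_rot_smul (hw _).2.continuousOn hz)
        (continuous_rot_smul (hw _).2.continuousOn hz), rotCoeff, rotCoeff]
    ring

/-- Taking components under the circle action commutes with tangential differentiation, up to a
shift of the weight. -/
theorem tangIter_rotCoeff {F : Cn n → ℂ} (hF : ContDiffOn ℝ (⊤ : ℕ∞) F (unitBall n)) {m : ℕ}
    (J : Fin m → TangIdx n) :
    ∃ s : ℤ, ∀ l, EqOn (tangIter J (rotCoeff l F)) (rotCoeff (l + s) (tangIter J F))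
      (unitBall n) := by
  induction m, J using tangIdx_induction with
  | zero J => exact ⟨0, fun l z _ => by simp⟩
  | cons m i J ih =>
    obtain ⟨s, hs⟩ := ih
    refine ⟨s + tangWeight i, fun l z hz => ?_⟩
    rw [tangIter_cons, tangIter_cons, tang_eqOn isOpen_unitBall (hs l) i hz,
      tang_rotCoeff (contDiffOn_tangIter isOpen_unitBall hF J) _ i hz, add_assoc]

/-- Scalar multiplication by a unimodular number. -/
def rotIso (t : Torus) : Cn n ≃ₗᵢ[ℝ] Cn n where
  toLinearEquiv := (LinearEquiv.smulOfNeZero ℂ (Cn n) (rot t) (rot_ne_zero t)).restrictScalars ℝ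
  norm_map' z := by
    change ‖rot t • z‖ = ‖z‖
    rw [norm_smul, norm_rot, one_mul]

theorem smul_mem_unitBall {r : ℝ} (hr : r ∈ Ioo (0 : ℝ) 1) (ζ : sphere (0 : Cn n) 1) :
    r • (ζ : Cn n) ∈ unitBall n := by
  simpa [unitBall, norm_smul, abs_of_pos hr.1] using hr.2

theorem continuous_dilate {F : Cn n → ℂ} (hF : ContinuousOn F (unitBall n)) {r : ℝ}
    (hr : r ∈ Ioo (0 : ℝ) 1) : Continuous fun ζ : sphere (0 : Cn n) 1 => F (r • (ζ : Cn n)) :=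
  hF.comp_continuous (by fun_prop) (smul_mem_unitBall hr)

/-- The circle action decomposes functions on spheres orthogonally: the norm is invariant under the
action, so it equals its average over the circle, to which Parseval's identity applies pointwise. -/
theorem sphereNormSq_eq_tsum_rotCoeff {F : Cn n → ℂ} (hF : ContinuousOn F (unitBall n)) {r : ℝ}
    (hr : r ∈ Ioo (0 : ℝ) 1) :
    sphereNormSq (fun ζ => F (r • ζ)) = ∑' l : ℤ, sphereNormSq (fun ζ => rotCoeff l F (r • ζ)) := by
  have hmeas : Measurable (fun p : sphere (0 : Cn n) 1 × Torus =>
      ‖F (rot p.2 • r • (p.1 : Cn n))‖ₑ ^ 2) := by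
    have : Continuous (fun p : sphere (0 : Cn n) 1 × Torus => F (rot p.2 • r • (p.1 : Cn n))) :=
      (continuousOn_rot_smul hF).comp_continuous
        (f := fun p : sphere (0 : Cn n) 1 × Torus => (r • (p.1 : Cn n), p.2)) (by fun_prop)
        fun p => ⟨smul_mem_unitBall hr p.1, trivial⟩
    exact this.enorm.measurable.pow_const 2
  calc sphereNormSq (fun ζ => F (r • ζ))
      = ∫⁻ t : Torus, sphereNormSq (fun ζ => F (r • ζ)) ∂AddCircle.haarAddCircle := by simp
    _ = ∫⁻ t : Torus, ∫⁻ ζ : sphere (0 : Cn n) 1, ‖F (rot t • r • (ζ : Cn n))‖ₑ ^ 2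
          ∂sphereMeasure n ∂AddCircle.haarAddCircle := by
        refine lintegral_congr fun t => ?_
        have hm := measurePreserving_sphereMap (n := n) (rotIso t)
        have := hm.lintegral_comp (f := fun ζ => ‖F (r • (ζ : Cn n))‖ₑ ^ 2)
          ((continuous_dilate hF hr).enorm.measurable.pow_const 2)
        rw [sphereNormSq, ← this]
        refine lintegral_congr fun ζ => ?_
        rw [smul_comm]
        rfl
    _ = ∫⁻ ζ : sphere (0 : Cn n) 1, ∫⁻ t : Torus, ‖F (rot t • r • (ζ : Cn n))‖ₑ ^ 2
          ∂AddCircle.haarAddCircle ∂sphereMeasure n :=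
        (lintegral_lintegral_swap (f := fun (ζ : sphere (0 : Cn n) 1) (t : Torus) =>
          ‖F (rot t • r • (ζ : Cn n))‖ₑ ^ 2) hmeas.aemeasurable).symm
    _ = ∫⁻ ζ : sphere (0 : Cn n) 1, ∑' l, ‖rotCoeff l F (r • (ζ : Cn n))‖ₑ ^ 2
          ∂sphereMeasure n :=
        lintegral_congr fun ζ => (tsum_enorm_sq_fourierCoeff
          (continuous_rot_smul hF (smul_mem_unitBall hr ζ))).symm
    _ = _ := lintegral_tsum fun l =>
        ((continuous_dilate (continuousOn_rotCoeff hF l)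
          hr).enorm.measurable.pow_const 2).aemeasurable

/-- For a holomorphic function the component of weight `l ≥ 0` is the homogeneous component of
degree `l`, and the negative weights do not occur. -/
theorem rotCoeff_of_isHolomorphic {g : Cn n → ℂ} (hg : IsHolomorphic g) (l : ℤ) {z : Cn n}
    (hz : z ∈ unitBall n) : rotCoeff l g z = if 0 ≤ l then homComp g l.toNat z else 0 := by
  have hu : DifferentiableOn ℂ (fun s : ℂ => g (s • z)) (closedBall 0 1) := by
    refine DifferentiableOn.comp hg (Differentiable.differentiableOn (by fun_prop)) fun s hs => ?_
    have hz' : ‖z‖ < 1 := by simpa [unitBall] using hz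
    have hs' : ‖s‖ ≤ 1 := by simpa using hs
    have : ‖s • z‖ < 1 := by
      rw [norm_smul]
      exact (mul_le_of_le_one_left (norm_nonneg z) hs').trans_lt hz'
    simpa [unitBall] using this
  exact fourierCoeff_of_differentiableOn hu l

theorem IsDecomp.rotCoeff {f g h : Cn n → ℂ} (d : IsDecomp f g h) (l : ℤ) {z : Cn n}
    (hz : z ∈ unitBall n) : rotCoeff l f z = (if 0 ≤ l then homComp g l.toNat z else 0) +
      conj (if l ≤ 0 then homComp h (-l).toNat z else 0) := by
  have e : (fun t : Torus => f (rot t • z)) =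
      fun t => 1 * g (rot t • z) + 1 * conj (h (rot t • z)) := by
    funext t
    rw [one_mul, one_mul, d.2.2 _ (rot_smul_mem hz t)]
  have hh : Continuous fun t : Torus => conj (h (rot t • z)) := Complex.continuous_conj.comp
    (continuous_rot_smul (IsHolomorphic.contDiffOn d.2.1).continuousOn hz)
  rw [PHDirichlet.rotCoeff, e, fourierCoeff_lincomb
    (continuous_rot_smul (IsHolomorphic.contDiffOn d.1).continuousOn hz) hh,
    fourierCoeff_conj]
  have h1 := rotCoeff_of_isHolomorphic d.1 l hz
  have h2 := rotCoeff_of_isHolomorphic d.2.1 (-l) hz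
  simp only [PHDirichlet.rotCoeff, Left.nonneg_neg_iff] at h1 h2
  rw [h1, h2, one_mul, one_mul]

theorem IsDecomp.contDiffOn {f g h : Cn n → ℂ} (d : IsDecomp f g h) :
    ContDiffOn ℝ (⊤ : ℕ∞) f (unitBall n) :=
  ((IsHolomorphic.contDiffOn d.1).add (Complex.conjCLE.contDiff.comp_contDiffOn
    (IsHolomorphic.contDiffOn d.2.1))).congr d.2.2

/-! ### The sums of tangential derivatives as series over homogeneous components -/

theorem tsum_int_eq_tsum_nat {F : ℤ → ℝ≥0∞} {u v : ℕ → ℝ≥0∞} (h0 : F 0 = 0) (hu0 : u 0 = 0)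
    (hv0 : v 0 = 0) (hu : ∀ m : ℕ, m ≠ 0 → F m = u m) (hv : ∀ m : ℕ, m ≠ 0 → F (-m) = v m) :
    ∑' l, F l = ∑' m, (u m + v m) := by
  rw [tsum_of_nat_of_neg_add_one ENNReal.summable ENNReal.summable, ENNReal.tsum_add]
  congr 1
  · refine tsum_congr fun m => ?_
    rcases eq_or_ne m 0 with rfl | hm
    · simp [h0, hu0]
    · exact hu m hm
  · rw [tsum_eq_zero_add' (f := v) ENNReal.summable, hv0, zero_add]
    refine tsum_congr fun m => ?_
    rw [← hv (m + 1) m.succ_ne_zero]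
    push_cast
    rfl

theorem sphereNormSq_const_mul (c : ℂ) (F : Cn n → ℂ) :
    sphereNormSq (fun ζ => c * F ζ) = ‖c‖ₑ ^ 2 * sphereNormSq F := by
  simp only [sphereNormSq, enorm_mul, mul_pow]
  exact lintegral_const_mul' _ _ (by simp)

theorem enorm_ofReal_pow_sq {r : ℝ} (hr : 0 ≤ r) (m : ℕ) :
    ‖(r : ℂ) ^ m‖ₑ ^ 2 = ENNReal.ofReal r ^ (2 * m) := by
  rw [← ofReal_norm, norm_pow, Complex.norm_real, Real.norm_of_nonneg hr,
    ENNReal.ofReal_pow hr, ← pow_mul, mul_comm]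

theorem sphereNormSq_dilate_homogeneous {F : Cn n → ℂ} {m : ℕ}
    (hF : ∀ (r : ℝ) z, F (r • z) = (r : ℂ) ^ m * F z) {k : ℕ} (J : Fin k → TangIdx n) {r : ℝ}
    (hr : 0 ≤ r) : sphereNormSq (fun ζ => tangIter J F (r • ζ)) =
      ENNReal.ofReal r ^ (2 * m) * sphereNormSq (tangIter J F) := by
  simp only [tangIter_homogeneous hF J r]
  rw [sphereNormSq_const_mul, enorm_ofReal_pow_sq hr]

theorem sphereNormSq_congr_dilate {F G : Cn n → ℂ} (h : EqOn F G (unitBall n)) {r : ℝ}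
    (hr : r ∈ Ioo (0 : ℝ) 1) :
    sphereNormSq (fun ζ => F (r • ζ)) = sphereNormSq (fun ζ => G (r • ζ)) :=
  lintegral_congr fun ζ => by simp only [h (smul_mem_unitBall hr ζ)]

/-- The contribution of the components of degree `m` to the norm of a tangential derivative. -/
def tangTerm {k : ℕ} (J : Fin k → TangIdx n) (g h : Cn n → ℂ) (m : ℕ) : ℝ≥0∞ :=
  sphereNormSq (tangIter J (homComp g m)) +
    sphereNormSq (tangIter J (fun z => conj (homComp h m z)))

theorem tangTerm_zero {k : ℕ} (J : Fin (k + 1) → TangIdx n) (g h : Cn n → ℂ) :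
    tangTerm J g h 0 = 0 := by
  simp only [tangTerm, homComp_zero, tangIter_const]
  simp [sphereNormSq]

/-- A tangential derivative of `f = g + h̄` on a sphere of radius `r`: the circle action separates
the homogeneous components. -/
theorem IsDecomp.sphereNormSq_tangIter {f g h : Cn n → ℂ} (d : IsDecomp f g h) {k : ℕ}
    (J : Fin (k + 1) → TangIdx n) {r : ℝ} (hr : r ∈ Ioo (0 : ℝ) 1) :
    sphereNormSq (fun ζ => tangIter J f (r • ζ)) =
      ∑' m, ENNReal.ofReal r ^ (2 * m) * tangTerm J g h m := by
  have hf := d.contDiffOn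
  obtain ⟨s, hs⟩ := tangIter_rotCoeff hf J
  rw [sphereNormSq_eq_tsum_rotCoeff (contDiffOn_tangIter isOpen_unitBall hf J).continuousOn hr,
    ← (Equiv.addRight s).tsum_eq]
  simp only [Equiv.coe_addRight]
  have e : ∀ l, sphereNormSq (fun ζ => PHDirichlet.rotCoeff (l + s) (tangIter J f) (r • ζ)) =
      sphereNormSq (fun ζ => tangIter J (PHDirichlet.rotCoeff l f) (r • ζ)) :=
    fun l => sphereNormSq_congr_dilate (hs l).symm hr
  simp only [e]
  have z1 : sphereNormSq (tangIter J (homComp g 0)) = 0 := by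
    rw [homComp_zero, tangIter_const]; simp [sphereNormSq]
  have z2 : sphereNormSq (tangIter J (fun z => conj (homComp h 0 z))) = 0 := by
    rw [homComp_zero, tangIter_const]; simp [sphereNormSq]
  simp only [tangTerm, mul_add]
  refine tsum_int_eq_tsum_nat ?_ (by simp [z1]) (by simp [z2]) (fun m hm => ?_) (fun m hm => ?_)
  -- The component of weight zero is constant and is killed by the fields, at least one of which
  -- is present.
  · have : EqOn (PHDirichlet.rotCoeff 0 f) (fun _ => g 0 + conj (h 0)) (unitBall n) := by
      intro z hz
      rw [d.rotCoeff 0 hz]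
      simp [homComp_zero]
    rw [sphereNormSq_congr_dilate (tangIter_eqOn isOpen_unitBall this J) hr, tangIter_const]
    simp [sphereNormSq]
  · have : EqOn (PHDirichlet.rotCoeff m f) (homComp g m) (unitBall n) := by
      intro z hz
      rw [d.rotCoeff m hz]
      simp [hm]
    rw [sphereNormSq_congr_dilate (tangIter_eqOn isOpen_unitBall this J) hr]
    exact sphereNormSq_dilate_homogeneous (homComp_real_smul d.1 m) J hr.1.le
  · have : EqOn (PHDirichlet.rotCoeff (-m) f) (fun z => conj (homComp h m z)) (unitBall n) := by
      intro z hz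
      rw [d.rotCoeff (-m) hz]
      simp [hm]
    rw [sphereNormSq_congr_dilate (tangIter_eqOn isOpen_unitBall this J) hr]
    refine sphereNormSq_dilate_homogeneous (fun r z => ?_) J hr.1.le
    rw [homComp_real_smul d.2.1, map_mul, map_pow, Complex.conj_ofReal]

/-- Monotone convergence as `r → 1`. -/
theorem iSup_tsum_pow_mul (a : ℕ → ℝ≥0∞) :
    ⨆ r ∈ Ioo (0 : ℝ) 1, ∑' m, ENNReal.ofReal r ^ (2 * m) * a m = ∑' m, a m := by
  refine le_antisymm (iSup₂_le fun r hr => ENNReal.tsum_le_tsum fun m => ?_) ?_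
  · exact mul_le_of_le_one_left' (pow_le_one' (ENNReal.ofReal_le_one.2 hr.2.le) _)
  · rw [ENNReal.tsum_eq_iSup_nat]
    refine iSup_le fun N => ?_
    have hlim : Filter.Tendsto (fun r : ℝ => ENNReal.ofReal r ^ (2 * N) *
        ∑ m ∈ Finset.range N, a m) (nhdsWithin 1 (Ioo 0 1))
        (nhds (∑ m ∈ Finset.range N, a m)) := by
      have h1 : Filter.Tendsto (fun r : ℝ => ENNReal.ofReal r ^ (2 * N)) (nhdsWithin 1 (Ioo 0 1))
          (nhds 1) := by
        have h0 : Continuous fun r : ℝ => ENNReal.ofReal r ^ (2 * N) :=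
          (ENNReal.continuous_pow _).comp ENNReal.continuous_ofReal
        have := h0.tendsto 1
        simp only [ENNReal.ofReal_one, one_pow] at this
        exact this.mono_left nhdsWithin_le_nhds
      simpa using ENNReal.Tendsto.mul_const h1 (b := ∑ m ∈ Finset.range N, a m) (by simp)
    have : (nhdsWithin (1 : ℝ) (Ioo 0 1)).NeBot := by
      rw [← mem_closure_iff_nhdsWithin_neBot, closure_Ioo zero_ne_one]
      simp
    refine le_of_tendsto hlim ?_
    filter_upwards [self_mem_nhdsWithin] with r hr
    refine le_trans ?_ (le_iSup₂_of_le r hr (ENNReal.sum_le_tsum (Finset.range N)))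
    rw [Finset.mul_sum]
    refine Finset.sum_le_sum fun m hm => mul_le_mul_left ?_ _
    have := Finset.mem_range.1 hm
    exact pow_le_pow_right_of_le_one' (ENNReal.ofReal_le_one.2 hr.2.le) (by omega)

theorem IsDecomp.tangHardySum_eq {f g h : Cn n → ℂ} (d : IsDecomp f g h) (k : ℕ) :
    tangHardySum (k + 1) f = ∑' m, ∑ J : Fin (k + 1) → TangIdx n, tangTerm J g h m := by
  rw [tangHardySum, Summable.tsum_finsetSum fun _ _ => ENNReal.summable]
  refine Finset.sum_congr rfl fun J _ => ?_
  rw [hardyNormSq, ← iSup_tsum_pow_mul]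
  exact iSup_congr fun r => iSup_congr fun hr => d.sphereNormSq_tangIter J hr

/-! ### Polar coordinates -/

theorem finrank_Cn : Module.finrank ℝ (Cn n) = 2 * n := by
  rw [← Module.finrank_mul_finrank ℝ ℂ (Cn n), Complex.finrank_real_complex]
  simp

/-- Integration in polar coordinates; the real dimension is `2n`. -/
theorem lintegral_polar (hn : 1 ≤ n) {φ : Cn n → ℝ≥0∞} (hφ : Measurable φ) :
    ∫⁻ z, φ z = ∫⁻ r in Ioi (0 : ℝ), ENNReal.ofReal (r ^ (2 * n - 1)) *
      ∫⁻ ζ, φ (r • (ζ : Cn n)) ∂(volume : Measure (Cn n)).toSphere := by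
  have : Nontrivial (Cn n) := by
    apply Module.nontrivial_of_finrank_pos (R := ℝ)
    rw [finrank_Cn]
    omega
  have hmp := (volume : Measure (Cn n)).measurePreserving_homeomorphUnitSphereProd
  have h1 : ∫⁻ z, φ z = ∫⁻ z : ({0}ᶜ : Set (Cn n)), φ z ∂(volume.comap Subtype.val) := by
    rw [lintegral_subtype_comap (measurableSet_singleton _).compl, restrict_compl_singleton]
  have hc : Continuous fun p : sphere (0 : Cn n) 1 × Ioi (0 : ℝ) => (p.2 : ℝ) • (p.1 : Cn n) := by
    fun_prop
  have hm : Measurable fun p : sphere (0 : Cn n) 1 × Ioi (0 : ℝ) =>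
      φ ((p.2 : ℝ) • (p.1 : Cn n)) := hφ.comp hc.measurable
  have h2 := hmp.lintegral_comp (f := fun p : sphere (0 : Cn n) 1 × Ioi (0 : ℝ) =>
    φ ((p.2 : ℝ) • (p.1 : Cn n))) hm
  have h3 : ∀ z : ({0}ᶜ : Set (Cn n)), φ (((homeomorphUnitSphereProd (Cn n) z).2 : ℝ) •
      ((homeomorphUnitSphereProd (Cn n) z).1 : Cn n)) = φ z := by
    intro z
    have hz : ‖(z : Cn n)‖ ≠ 0 := norm_ne_zero_iff.2 z.2
    simp [smul_smul, hz]
  simp only [h3] at h2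
  rw [h1, h2, lintegral_prod_symm' _ hm, finrank_Cn, Measure.volumeIoiPow,
    lintegral_withDensity_eq_lintegral_mul _ (by fun_prop)]
  · rw [← lintegral_subtype_comap measurableSet_Ioi fun r : ℝ =>
      ENNReal.ofReal (r ^ (2 * n - 1)) *
      ∫⁻ ζ, φ (r • (ζ : Cn n)) ∂(volume : Measure (Cn n)).toSphere]
    rfl
  · exact hm.lintegral_prod_left'

/-- The total mass of the surface measure of the unit sphere. -/
def sphereMass (n : ℕ) : ℝ≥0∞ := (volume : Measure (Cn n)).toSphere univ

theorem sphereMass_ne_zero (hn : 1 ≤ n) : sphereMass n ≠ 0 := by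
  have : Nontrivial (Cn n) := by
    apply Module.nontrivial_of_finrank_pos (R := ℝ)
    rw [finrank_Cn]
    omega
  rw [sphereMass, Measure.measure_univ_ne_zero]
  exact Measure.toSphere_ne_zero _

theorem sphereMass_ne_top : sphereMass n ≠ ∞ := measure_ne_top _ _

theorem toSphere_eq_smul (hn : 1 ≤ n) :
    (volume : Measure (Cn n)).toSphere = sphereMass n • sphereMeasure n := by
  rw [sphereMeasure, smul_smul]
  change _ = (sphereMass n * (sphereMass n)⁻¹) • _
  rw [ENNReal.mul_inv_cancel (sphereMass_ne_zero hn) sphereMass_ne_top, one_smul]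

/-- The normalizing constant of the weight `(1 - |z|²)^s`. -/
def ballConst (n : ℕ) (s : ℝ) : ℝ :=
  Real.Gamma (s + n + 1) / (Real.pi ^ n * Real.Gamma (s + 1))

theorem ballNormSq_eq (hn : 1 ≤ n) (s : ℝ) {F : Cn n → ℂ} (hF : ContinuousOn F (unitBall n)) :
    ballNormSq s F = ∫⁻ r in Ioo (0 : ℝ) 1, ENNReal.ofReal (r ^ (2 * n - 1)) *
      (ENNReal.ofReal (ballConst n s * (1 - r ^ 2) ^ s) *
        (sphereMass n * sphereNormSq (fun ζ => F (r • ζ)))) := by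
  classical
  set w : Cn n → ℝ≥0∞ := fun z => ENNReal.ofReal
    (Real.Gamma (s + n + 1) / (Real.pi ^ n * Real.Gamma (s + 1)) * (1 - ‖z‖ ^ 2) ^ s) with hw
  have hwm : Measurable w := by
    apply Measurable.ennreal_ofReal
    fun_prop
  have hG : Measurable ((unitBall n).piecewise F fun _ => 0) :=
    hF.measurable_piecewise continuousOn_const isOpen_unitBall.measurableSet
  -- Outside the ball `F` is arbitrary, so it is cut off to get a measurable integrand on `ℂⁿ`.
  set φ : Cn n → ℝ≥0∞ := fun z => (unitBall n).indicator 1 z *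
    (w z * ‖(unitBall n).piecewise F (fun _ => 0) z‖ₑ ^ 2) with hφ
  have hφm : Measurable φ :=
    (measurable_one.indicator isOpen_unitBall.measurableSet).mul
      (hwm.mul (hG.enorm.pow_const 2))
  have h1 : ballNormSq s F = ∫⁻ z, φ z := by
    have hFm : AEMeasurable (fun z => ‖F z‖ₑ ^ 2)
        ((volume : Measure (Cn n)).restrict (unitBall n)) :=
      (hF.aemeasurable isOpen_unitBall.measurableSet).enorm.pow_const 2
    rw [ballNormSq, ballMeasure, lintegral_withDensity_eq_lintegral_mul₀ hwm.aemeasurable hFm,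
      ← lintegral_indicator isOpen_unitBall.measurableSet]
    refine lintegral_congr fun z => ?_
    by_cases hz : z ∈ unitBall n <;> simp [hφ, hz, hw]
  rw [h1, lintegral_polar hn hφm]
  rw [← lintegral_indicator measurableSet_Ioi, ← lintegral_indicator measurableSet_Ioo]
  refine lintegral_congr fun r => ?_
  by_cases hr0 : 0 < r
  · rw [indicator_of_mem (mem_Ioi.2 hr0)]
    have hnorm : ∀ ζ : sphere (0 : Cn n) 1, ‖r • (ζ : Cn n)‖ = r := fun ζ => by
      simp [norm_smul, abs_of_pos hr0]
    by_cases hr1 : r < 1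
    · rw [indicator_of_mem (mem_Ioo.2 ⟨hr0, hr1⟩)]
      congr 1
      have hm : ∀ ζ : sphere (0 : Cn n) 1, r • (ζ : Cn n) ∈ unitBall n :=
        smul_mem_unitBall ⟨hr0, hr1⟩
      have hmeas : Measurable fun ζ : sphere (0 : Cn n) 1 => ‖F (r • (ζ : Cn n))‖ₑ ^ 2 :=
        ((continuous_dilate hF ⟨hr0, hr1⟩).enorm.measurable.pow_const 2)
      have e : ∀ ζ : sphere (0 : Cn n) 1, φ (r • (ζ : Cn n)) =
          ENNReal.ofReal (ballConst n s * (1 - r ^ 2) ^ s) * ‖F (r • (ζ : Cn n))‖ₑ ^ 2 := by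
        intro ζ
        simp [hφ, hm ζ, hw, hnorm ζ, ballConst]
      simp only [e]
      rw [lintegral_const_mul _ hmeas, toSphere_eq_smul hn, lintegral_smul_measure, smul_eq_mul]
      rfl
    · rw [indicator_of_notMem (fun h => hr1 h.2)]
      have e : ∀ ζ : sphere (0 : Cn n) 1, φ (r • (ζ : Cn n)) = 0 := by
        intro ζ
        have : r • (ζ : Cn n) ∉ unitBall n := by
          simpa [unitBall, hnorm ζ] using hr1
        simp [hφ, this]
      simp [e]
  · rw [indicator_of_notMem (fun h => hr0 (mem_Ioi.1 h)),
      indicator_of_notMem (fun h => hr0 (mem_Ioo.1 h).1)]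

/-- The factor with which a component of degree `m` enters a weighted norm on the ball. -/
def ballWeight (n : ℕ) (s : ℝ) (m : ℕ) : ℝ≥0∞ :=
  ∫⁻ r in Ioo (0 : ℝ) 1, ENNReal.ofReal (r ^ (2 * n - 1)) *
    (ENNReal.ofReal (ballConst n s * (1 - r ^ 2) ^ s) *
      (sphereMass n * ENNReal.ofReal r ^ (2 * m)))

theorem IsDecomp.tangBallSum_eq (hn : 1 ≤ n) (s : ℝ) {f g h : Cn n → ℂ} (d : IsDecomp f g h)
    (k : ℕ) : tangBallSum (k + 1) s f =
      ∑' m, ballWeight n s m * ∑ J : Fin (k + 1) → TangIdx n, tangTerm J g h m := by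
  simp only [Finset.mul_sum]
  rw [tangBallSum, Summable.tsum_finsetSum fun _ _ => ENNReal.summable]
  refine Finset.sum_congr rfl fun J _ => ?_
  rw [ballNormSq_eq hn s (contDiffOn_tangIter isOpen_unitBall d.contDiffOn J).continuousOn]
  have e : ∀ m, ballWeight n s m * tangTerm J g h m = ∫⁻ r in Ioo (0 : ℝ) 1,
      ENNReal.ofReal (r ^ (2 * n - 1)) * (ENNReal.ofReal (ballConst n s * (1 - r ^ 2) ^ s) *
      (sphereMass n * ENNReal.ofReal r ^ (2 * m))) * tangTerm J g h m := by
    intro m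
    rw [ballWeight, lintegral_mul_const]
    fun_prop
  simp only [e]
  rw [← lintegral_tsum fun m => by fun_prop]
  refine setLIntegral_congr_fun measurableSet_Ioo fun r hr => ?_
  rw [d.sphereNormSq_tangIter J hr, ← ENNReal.tsum_mul_left, ← ENNReal.tsum_mul_left,
    ← ENNReal.tsum_mul_left]
  exact tsum_congr fun m => by ring

/-! ### Asymptotics of the weights -/

/-- Half a Beta integral, by induction on `k` through
`(1 - r²)^(k+1) = (1 - r²)^k - r² (1 - r²)^k`. -/
theorem integral_pow_mul_one_sub_sq_pow (k : ℕ) : ∀ a : ℕ, 1 ≤ a →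
    (∫ r in (0 : ℝ)..1, r ^ (2 * a - 1) * (1 - r ^ 2) ^ k) =
      (k.factorial : ℝ) / (2 * a.ascFactorial (k + 1)) := by
  induction k with
  | zero =>
    intro a ha
    have h : 2 * a - 1 + 1 = 2 * a := by omega
    simp only [pow_zero, mul_one, integral_pow, one_pow, h, zero_add, Nat.factorial_zero,
      Nat.cast_one, Nat.ascFactorial_succ, Nat.ascFactorial_zero, add_zero]
    rw [zero_pow (by omega), sub_zero]
    congr 1
    have : ((2 * a - 1 : ℕ) : ℝ) + 1 = ((2 * a - 1 + 1 : ℕ) : ℝ) := by push_cast; rfl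
    rw [this, h]
    push_cast
    rfl
  | succ k ih =>
    intro a ha
    have e : ∀ r : ℝ, r ^ (2 * a - 1) * (1 - r ^ 2) ^ (k + 1) =
        r ^ (2 * a - 1) * (1 - r ^ 2) ^ k - r ^ (2 * (a + 1) - 1) * (1 - r ^ 2) ^ k := by
      intro r
      have : 2 * (a + 1) - 1 = 2 * a - 1 + 2 := by omega
      rw [this]
      ring
    simp only [e]
    rw [intervalIntegral.integral_sub (Continuous.intervalIntegrable (by fun_prop) _ _)
      (Continuous.intervalIntegrable (by fun_prop) _ _), ih a ha, ih (a + 1) (by omega)]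
    have h1 : (a : ℝ) * (a + 1).ascFactorial (k + 1) = (a + k + 1) * a.ascFactorial (k + 1) := by
      have := Nat.succ_ascFactorial a (k + 1)
      simp only [Nat.succ_eq_add_one] at this
      exact_mod_cast this
    have h2 : (a.ascFactorial (k + 1 + 1) : ℝ) = (a + k + 1) * a.ascFactorial (k + 1) := by
      have := Nat.ascFactorial_succ (n := a) (k := k + 1)
      exact_mod_cast this
    have hX : (0 : ℝ) < a.ascFactorial (k + 1) := by
      obtain ⟨b, rfl⟩ := Nat.exists_eq_succ_of_ne_zero (by omega : a ≠ 0)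
      exact_mod_cast Nat.ascFactorial_pos b _
    have hY : (0 : ℝ) < (a + 1).ascFactorial (k + 1) := by exact_mod_cast Nat.ascFactorial_pos a _
    have ha' : (0 : ℝ) < a := by exact_mod_cast ha
    have hak : (0 : ℝ) < a + k + 1 := by positivity
    rw [h2, Nat.factorial_succ]
    push_cast
    have hY' : ((a + 1).ascFactorial (k + 1) : ℝ) = (a + k + 1) * a.ascFactorial (k + 1) / a := by
      field_simp
      linarith
    rw [hY']
    field_simp
    ring

theorem ballConst_pos (n k : ℕ) : 0 < ballConst n k := by
  have h1 : 0 < Real.Gamma ((k : ℝ) + n + 1) := Real.Gamma_pos_of_pos (by positivity)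
  have h2 : 0 < Real.Gamma ((k : ℝ) + 1) := Real.Gamma_pos_of_pos (by positivity)
  rw [ballConst]
  have := Real.pi_pos
  positivity

/-- The constant in front of the weights `ballWeight`. -/
def ballWeightConst (n k : ℕ) : ℝ := (sphereMass n).toReal * ballConst n k * (k.factorial / 2)

theorem ballWeightConst_pos (hn : 1 ≤ n) (k : ℕ) : 0 < ballWeightConst n k := by
  have := ENNReal.toReal_pos (sphereMass_ne_zero hn) sphereMass_ne_top
  have := ballConst_pos n k
  have : (0 : ℝ) < k.factorial := by exact_mod_cast k.factorial_pos
  rw [ballWeightConst]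
  positivity

theorem ballWeight_eq (hn : 1 ≤ n) (k m : ℕ) : ballWeight n k m =
    ENNReal.ofReal (ballWeightConst n k / (n + m).ascFactorial (k + 1)) := by
  have hC := ballConst_pos n k
  have hM : 0 ≤ (sphereMass n).toReal := ENNReal.toReal_nonneg
  have e : ballWeight n k m = ∫⁻ r in Ioo (0 : ℝ) 1, ENNReal.ofReal ((sphereMass n).toReal *
      ballConst n k * (r ^ (2 * (n + m) - 1) * (1 - r ^ 2) ^ k)) := by
    refine setLIntegral_congr_fun measurableSet_Ioo fun r hr => ?_
    have h1 : 0 ≤ 1 - r ^ 2 := by nlinarith [hr.1, hr.2]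
    have hr0 := hr.1.le
    have hexp : 2 * (n + m) - 1 = 2 * n - 1 + 2 * m := by omega
    simp only [Real.rpow_natCast]
    nth_rw 1 [← ENNReal.ofReal_toReal (sphereMass_ne_top (n := n))]
    rw [← ENNReal.ofReal_pow hr0, ← ENNReal.ofReal_mul hM, ← ENNReal.ofReal_mul (by positivity),
      ← ENNReal.ofReal_mul (by positivity), hexp]
    congr 1
    ring
  have hcont : Continuous fun r : ℝ => (sphereMass n).toReal *
      ballConst n k * (r ^ (2 * (n + m) - 1) * (1 - r ^ 2) ^ k) := by fun_prop
  rw [e, ← ofReal_integral_eq_lintegral_ofReal]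
  · rw [← integral_Ioc_eq_integral_Ioo, ← intervalIntegral.integral_of_le zero_le_one,
      intervalIntegral.integral_const_mul, integral_pow_mul_one_sub_sq_pow k (n + m) (by omega),
      ballWeightConst]
    congr 1
    field_simp
  · exact (hcont.integrableOn_Icc (a := 0) (b := 1)).mono_set Ioo_subset_Icc_self
  · filter_upwards [ae_restrict_mem measurableSet_Ioo] with r hr
    have h1 : 0 ≤ 1 - r ^ 2 := by nlinarith [hr.1, hr.2]
    have hr0 := hr.1.le
    positivity

theorem ascFactorial_le (a c j m : ℕ) (hm : 1 ≤ m) (hc : a ≤ c * m) :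
    (a + 1).ascFactorial j ≤ ((c + j) * m) ^ j := by
  refine (Nat.ascFactorial_le_pow_add a j).trans (Nat.pow_le_pow_left ?_ j)
  nlinarith

/-- The weights `ballWeight` decay like `m ^ (-(k + 1))`, so against the growth `m ^ (n + k + 1)` of
the `(n + k + 1)`-fold tangential derivatives they leave `m ^ n`. -/
theorem ballWeight_bounds (hn : 1 ≤ n) (k : ℕ) {m : ℕ} (hm : 1 ≤ m) :
    ballWeightConst n k / (n + k + 1) ^ (k + 1) * m ^ n ≤
        ballWeightConst n k / (n + m).ascFactorial (k + 1) * m ^ (n + k + 1) ∧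
      ballWeightConst n k / (n + m).ascFactorial (k + 1) * m ^ (n + k + 1) ≤
        ballWeightConst n k * m ^ n := by
  have hK := ballWeightConst_pos hn k
  have hm0 : (0 : ℝ) < m := by exact_mod_cast hm
  obtain ⟨a, ha⟩ := Nat.exists_eq_succ_of_ne_zero (by omega : n + m ≠ 0)
  have hX : (0 : ℝ) < (n + m).ascFactorial (k + 1) := by
    rw [ha]; exact_mod_cast Nat.ascFactorial_pos a _
  have hup : ((n + m).ascFactorial (k + 1) : ℝ) ≤ ((n + k + 1) * m) ^ (k + 1) := by
    have h := ascFactorial_le a n (k + 1) m hm (by nlinarith)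
    rw [← Nat.succ_eq_add_one, ← ha] at h
    exact_mod_cast h
  have hlo : (m : ℝ) ^ (k + 1) ≤ (n + m).ascFactorial (k + 1) := by
    have h := (Nat.pow_le_pow_left (by omega : m ≤ n + m) (k + 1)).trans
      (by rw [ha]; exact Nat.pow_succ_le_ascFactorial _ _ : (n + m) ^ (k + 1) ≤
        (n + m).ascFactorial (k + 1))
    exact_mod_cast h
  have hpow : (m : ℝ) ^ (n + k + 1) = m ^ (k + 1) * m ^ n := by ring
  rw [hpow]
  constructor
  · rw [div_mul_eq_mul_div, div_mul_eq_mul_div, div_le_div_iff₀ (by positivity) hX]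
    rw [mul_pow] at hup
    calc _ ≤ ballWeightConst n k * m ^ n * ((n + k + 1) ^ (k + 1) * m ^ (k + 1)) := by gcongr
      _ = _ := by ring
  · rw [div_mul_eq_mul_div, div_le_iff₀ hX]
    calc _ = ballWeightConst n k * m ^ n * m ^ (k + 1) := by ring
      _ ≤ _ := by gcongr

/-- The weight of the components of degree `m` in the Dirichlet seminorm. -/
def dirichletWeight (n m : ℕ) : ℝ := m * (n.ascFactorial m : ℝ) / (m.factorial : ℝ)

/-- The Dirichlet weight `m (n)_m / m!` equals `m (m + 1) ⋯ (m + n - 1) / (n - 1)!`. -/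
theorem dirichletWeight_bounds (hn : 1 ≤ n) {m : ℕ} (hm : 1 ≤ m) :
    ((n - 1).factorial : ℝ)⁻¹ * m ^ n ≤ dirichletWeight n m ∧
      dirichletWeight n m ≤ n ^ n * m ^ n := by
  obtain ⟨a, rfl⟩ : ∃ a, n = a + 1 := ⟨n - 1, by omega⟩
  have h1 : (a.factorial : ℝ) * (a + 1).ascFactorial m = m.factorial * (m + 1).ascFactorial a := by
    have := (Nat.factorial_mul_ascFactorial a m).trans
      ((congrArg _ (Nat.add_comm a m)).trans (Nat.factorial_mul_ascFactorial m a).symm)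
    exact_mod_cast this
  have ha : (1 : ℝ) ≤ a.factorial := by exact_mod_cast a.factorial_pos
  have hmf : (0 : ℝ) < m.factorial := by exact_mod_cast m.factorial_pos
  have hm0 : (0 : ℝ) < m := by exact_mod_cast hm
  have e : dirichletWeight (a + 1) m = (a.factorial : ℝ)⁻¹ * (m * (m + 1).ascFactorial a) := by
    have h0 : (a.factorial : ℝ) ≠ 0 := by positivity
    have : ((a + 1).ascFactorial m : ℝ) = m.factorial * (m + 1).ascFactorial a / a.factorial := by
      rw [← h1]; field_simp
    rw [dirichletWeight, this]
    field_simp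
  have hlo : (m : ℝ) ^ a ≤ (m + 1).ascFactorial a := by
    have := (Nat.pow_le_pow_left (by omega : m ≤ m + 1) a).trans
      (Nat.pow_succ_le_ascFactorial (m + 1) a)
    exact_mod_cast this
  have hup : ((m + 1).ascFactorial a : ℝ) ≤ ((a + 1) * m) ^ a := by
    have := ascFactorial_le m 1 a m hm (by omega)
    rw [Nat.add_comm 1 a] at this
    exact_mod_cast this
  rw [e]
  simp only [Nat.add_sub_cancel]
  constructor
  · rw [pow_succ, mul_comm ((m : ℝ) ^ a)]
    gcongr
  · calc (a.factorial : ℝ)⁻¹ * (m * (m + 1).ascFactorial a) ≤ 1 * (m * ((a + 1) * m) ^ a) := by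
          gcongr
          exact inv_le_one_of_one_le₀ ha
      _ = (a + 1) ^ a * m ^ (a + 1) := by rw [mul_pow]; ring
      _ ≤ (a + 1) ^ (a + 1) * m ^ (a + 1) := by
          gcongr
          · exact le_add_of_nonneg_left a.cast_nonneg
          · omega
      _ = _ := by push_cast; ring

/-! ### Comparison of the seminorms -/

/-- The sum over all `j`-fold tangential derivatives of the degree `m` contributions is comparable
to `m ^ j` times the norms of the components of degree `m`. -/
theorem sum_tangTerm_bounds (hn : 2 ≤ n) {g h : Cn n → ℂ} (hg : IsHolomorphic g)
    (hh : IsHolomorphic h) (j : ℕ) {m : ℕ} (hm : 1 ≤ m) :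
    ENNReal.ofReal (m ^ j) * (sphereNormSq (homComp g m) + sphereNormSq (homComp h m)) ≤
        ∑ J : Fin j → TangIdx n, tangTerm J g h m ∧
      ∑ J : Fin j → TangIdx n, tangTerm J g h m ≤ ENNReal.ofReal (SmoothFun.tangConst n j * m ^ j) *
        (sphereNormSq (homComp g m) + sphereNormSq (homComp h m)) := by
  have bg := (isBihom_homCompA hg m).sum_sphereSq_tangIterA_bounds hn hm (by simp) (Or.inr rfl) j
  have bh := (isBihom_homCompA hh m).cj.sum_sphereSq_tangIterA_bounds hn hm (by simp)
    (Or.inl rfl) j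
  rw [SmoothFun.sphereSq_cj] at bh
  have eg : ∀ J : Fin j → TangIdx n, sphereNormSq (tangIter J (homComp g m)) =
      ENNReal.ofReal (SmoothFun.sphereSq (SmoothFun.tangIterA J (homCompA hg m))) := fun J =>
    SmoothFun.sphereNormSq_eq (SmoothFun.tangIterA J (homCompA hg m))
  have eh : ∀ J : Fin j → TangIdx n, sphereNormSq (tangIter J fun z => conj (homComp h m z)) =
      ENNReal.ofReal (SmoothFun.sphereSq
        (SmoothFun.tangIterA J (SmoothFun.cj (homCompA hh m)))) := fun J =>
    SmoothFun.sphereNormSq_eq (SmoothFun.tangIterA J (SmoothFun.cj (homCompA hh m)))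
  have eg0 : sphereNormSq (homComp g m) = ENNReal.ofReal (SmoothFun.sphereSq (homCompA hg m)) :=
    SmoothFun.sphereNormSq_eq (homCompA hg m)
  have eh0 : sphereNormSq (homComp h m) = ENNReal.ofReal (SmoothFun.sphereSq (homCompA hh m)) :=
    SmoothFun.sphereNormSq_eq (homCompA hh m)
  have hC := (SmoothFun.tangConst_pos hn j).le
  simp only [tangTerm, eg, eh, eg0, eh0, Finset.sum_add_distrib, mul_add]
  rw [← ENNReal.ofReal_sum_of_nonneg fun _ _ => SmoothFun.sphereSq_nonneg _,
    ← ENNReal.ofReal_sum_of_nonneg fun _ _ => SmoothFun.sphereSq_nonneg _,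
    ← ENNReal.ofReal_mul (by positivity), ← ENNReal.ofReal_mul (by positivity),
    ← ENNReal.ofReal_mul (by positivity), ← ENNReal.ofReal_mul (by positivity)]
  exact ⟨add_le_add (ENNReal.ofReal_le_ofReal bg.1) (ENNReal.ofReal_le_ofReal bh.1),
    add_le_add (ENNReal.ofReal_le_ofReal bg.2) (ENNReal.ofReal_le_ofReal bh.2)⟩

/-- A series of `j`-fold tangential derivatives whose weights are comparable to `m ^ (n - j)` is
comparable to the Dirichlet seminorm. -/
theorem exists_comparison (hn : 2 ≤ n) (j : ℕ) {w : ℕ → ℝ} {p q : ℝ} (hp : 0 < p) (hq : 0 < q)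
    (hw0 : ∀ m, 0 ≤ w m)
    (hw : ∀ m : ℕ, 1 ≤ m → p * m ^ n ≤ w m * m ^ (j + 1) ∧ w m * m ^ (j + 1) ≤ q * m ^ n) :
    ∃ c : ℝ, 0 < c ∧ c ≤ 1 ∧ ∀ g h : Cn n → ℂ, IsHolomorphic g → IsHolomorphic h →
      ENNReal.ofReal c * (dirichletSq g + dirichletSq h) ≤
          ∑' m, ENNReal.ofReal (w m) * ∑ J : Fin (j + 1) → TangIdx n, tangTerm J g h m ∧
        ∑' m, ENNReal.ofReal (w m) * ∑ J : Fin (j + 1) → TangIdx n, tangTerm J g h m ≤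
          ENNReal.ofReal c⁻¹ * (dirichletSq g + dirichletSq h) := by
  have hn1 : 1 ≤ n := by omega
  have hn0 : (0 : ℝ) < n := by exact_mod_cast hn1
  have hC := SmoothFun.tangConst_pos hn (j + 1)
  have hf : (0 : ℝ) < (n - 1).factorial := by exact_mod_cast (n - 1).factorial_pos
  -- The constants `c₁` and `c₂` are the ones that the bounds on the single terms give for the two
  -- inequalities.
  set c₁ : ℝ := p / n ^ n with hc₁
  set c₂ : ℝ := SmoothFun.tangConst n (j + 1) * q * (n - 1).factorial with hc₂
  have hc₁0 : 0 < c₁ := by positivity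
  have hc₂0 : 0 < c₂ := by positivity
  set c : ℝ := min (min c₁ c₂⁻¹) 1 with hc
  have hc0 : 0 < c := lt_min (lt_min hc₁0 (inv_pos.2 hc₂0)) one_pos
  have hcc₁ : c ≤ c₁ := (min_le_left _ _).trans (min_le_left _ _)
  have hcc₂ : c₂ ≤ c⁻¹ := by
    rw [le_inv_comm₀ hc₂0 hc0]
    exact (min_le_left _ _).trans (min_le_right _ _)
  refine ⟨c, hc0, min_le_right _ _, fun g h hg hh => ?_⟩
  have hD : dirichletSq g + dirichletSq h = ∑' m, ENNReal.ofReal (dirichletWeight n m) *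
      (sphereNormSq (homComp g m) + sphereNormSq (homComp h m)) := by
    simp only [mul_add, ENNReal.tsum_add]
    rfl
  rw [hD, ← ENNReal.tsum_mul_left, ← ENNReal.tsum_mul_left]
  constructor
  · refine ENNReal.tsum_le_tsum fun m => ?_
    rcases Nat.eq_zero_or_pos m with rfl | hm
    -- The bounds need `m ≥ 1`; the constant term does not enter either side.
    · simp [dirichletWeight]
    · refine le_trans ?_ (mul_le_mul_right (sum_tangTerm_bounds hn hg hh (j + 1) hm).1 _)
      rw [← mul_assoc, ← mul_assoc, ← ENNReal.ofReal_mul hc0.le, ← ENNReal.ofReal_mul (hw0 m)]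
      refine mul_le_mul_left (ENNReal.ofReal_le_ofReal ?_) _
      refine le_trans ?_ (hw m hm).1
      have hd := (dirichletWeight_bounds hn1 hm).2
      calc c * dirichletWeight n m ≤ c * (n ^ n * m ^ n) := by gcongr
        _ ≤ c₁ * (n ^ n * m ^ n) := by gcongr
        _ = p * m ^ n := by rw [hc₁]; field_simp
  · refine ENNReal.tsum_le_tsum fun m => ?_
    rcases Nat.eq_zero_or_pos m with rfl | hm
    · simp [tangTerm_zero]
    · refine le_trans (mul_le_mul_right (sum_tangTerm_bounds hn hg hh (j + 1) hm).2 _) ?_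
      rw [← mul_assoc, ← mul_assoc, ← ENNReal.ofReal_mul (hw0 m),
        ← ENNReal.ofReal_mul (inv_nonneg.2 hc0.le)]
      refine mul_le_mul_left (ENNReal.ofReal_le_ofReal ?_) _
      have hd := (dirichletWeight_bounds hn1 hm).1
      have hd0 : 0 ≤ dirichletWeight n m := le_trans (by positivity) hd
      calc w m * (SmoothFun.tangConst n (j + 1) * m ^ (j + 1))
          = SmoothFun.tangConst n (j + 1) * (w m * m ^ (j + 1)) := by ring
        _ ≤ SmoothFun.tangConst n (j + 1) * (q * m ^ n) :=
            mul_le_mul_of_nonneg_left (hw m hm).2 hC.le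
        _ = c₂ * (((n - 1).factorial : ℝ)⁻¹ * m ^ n) := by rw [hc₂]; field_simp
        _ ≤ c₂ * dirichletWeight n m := by gcongr
        _ ≤ c⁻¹ * dirichletWeight n m := by gcongr

theorem exists_comparison_tangHardySum (n : ℕ) (hn : 2 ≤ n) :
    ∃ c : ℝ, 0 < c ∧ c ≤ 1 ∧ ∀ f g h : Cn n → ℂ, IsDecomp f g h →
      ENNReal.ofReal c * phDirichletSq f ≤ tangHardySum n f ∧
        tangHardySum n f ≤ ENNReal.ofReal c⁻¹ * phDirichletSq f := by
  obtain ⟨j, rfl⟩ : ∃ j, n = j + 1 := ⟨n - 1, by omega⟩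
  obtain ⟨c, hc0, hc1, H⟩ := exists_comparison hn j (w := fun _ => 1) one_pos one_pos
    (fun _ => zero_le_one) (fun m _ => ⟨le_rfl, le_rfl⟩)
  refine ⟨c, hc0, hc1, fun f g h d => ?_⟩
  rw [phDirichletSq_eq d, d.tangHardySum_eq]
  simpa using H g h d.1 d.2.1

theorem exists_comparison_tangBallSum (n : ℕ) (hn : 2 ≤ n) (k : ℕ) :
    ∃ c : ℝ, 0 < c ∧ c ≤ 1 ∧ ∀ f g h : Cn n → ℂ, IsDecomp f g h →
      ENNReal.ofReal c * phDirichletSq f ≤ tangBallSum (n + k + 1) k f ∧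
        tangBallSum (n + k + 1) k f ≤ ENNReal.ofReal c⁻¹ * phDirichletSq f := by
  have hn1 : 1 ≤ n := by omega
  have hK := ballWeightConst_pos hn1 k
  obtain ⟨c, hc0, hc1, H⟩ := exists_comparison hn (n + k)
    (w := fun m => ballWeightConst n k / (n + m).ascFactorial (k + 1))
    (p := ballWeightConst n k / (n + k + 1) ^ (k + 1)) (q := ballWeightConst n k)
    (by positivity) hK (fun _ => by positivity) (fun m hm => ballWeight_bounds hn1 k hm)
  refine ⟨c, hc0, hc1, fun f g h d => ?_⟩
  rw [phDirichletSq_eq d, d.tangBallSum_eq hn1]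
  simpa only [ballWeight_eq hn1] using H g h d.1 d.2.1

/-! ### Pluriharmonic functions as sums of holomorphic and conjugate holomorphic ones -/

/-- Wirtinger derivatives of a `C²` function commute. -/
theorem wirt_wirt_eq {F : Cn n → ℂ} {z : Cn n} (hF : ContDiffAt ℝ 2 F z) (j k : Fin n) :
    wirt j (wirt k F) z = wirt k (wirt j F) z ∧
      wirtBar j (wirt k F) z = wirt k (wirtBar j F) z := by
  have hd : ∀ v, DifferentiableAt ℝ (fun x => fderiv ℝ F x v) z := fun v =>
    ((hF.fderiv_right (m := 1) (by norm_num)).differentiableAt one_ne_zero).clm_apply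
      (differentiableAt_const v)
  have e : ∀ (c : ℂ) (k : Fin n) (w : Cn n), fderiv ℝ (fun x =>
      (fderiv ℝ F x (EuclideanSpace.single k 1) +
        c * fderiv ℝ F x (EuclideanSpace.single k Complex.I)) / 2) z w =
      (fderiv ℝ (fun x => fderiv ℝ F x (EuclideanSpace.single k 1)) z w +
        c * fderiv ℝ (fun x => fderiv ℝ F x (EuclideanSpace.single k Complex.I)) z w) / 2 := by
    intro c k w
    have h := (((hd (EuclideanSpace.single k 1)).hasFDerivAt.add
      ((hd (EuclideanSpace.single k Complex.I)).hasFDerivAt.const_mul c)).mul_const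
        (2⁻¹ : ℂ)).fderiv
    simp only [div_eq_mul_inv]
    refine (congrArg (fun L : Cn n →L[ℝ] ℂ => L w) h).trans ?_
    simp
    ring
  have ew : ∀ k, wirt k F = fun x => (fderiv ℝ F x (EuclideanSpace.single k 1) +
        -Complex.I * fderiv ℝ F x (EuclideanSpace.single k Complex.I)) / 2 := fun k =>
    funext fun x => by rw [wirt]; ring
  have eb : ∀ k, wirtBar k F = fun x => (fderiv ℝ F x (EuclideanSpace.single k 1) +
        Complex.I * fderiv ℝ F x (EuclideanSpace.single k Complex.I)) / 2 := fun k => rfl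
  have comm := fun a b => fderiv_fderiv_comm hF (EuclideanSpace.single k a)
    (EuclideanSpace.single j b)
  rw [ew k, ew j, eb j]
  simp only [wirt, wirtBar, e, comm]
  constructor <;> ring

theorem IsPluriharmonic.contDiffAt {f : Cn n → ℂ} (hf : IsPluriharmonic f) {z : Cn n}
    (hz : z ∈ unitBall n) : ContDiffAt ℝ 2 f z :=
  hf.1.contDiffAt (isOpen_unitBall.mem_nhds hz)

theorem differentiableAt_wirt {f : Cn n → ℂ} {z : Cn n} (hf : ContDiffAt ℝ 2 f z) (k : Fin n) :
    DifferentiableAt ℝ (wirt k f) z := by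
  have hd : ∀ v, DifferentiableAt ℝ (fun x => fderiv ℝ f x v) z := fun v =>
    ((hf.fderiv_right (m := 1) (by norm_num)).differentiableAt one_ne_zero).clm_apply
      (differentiableAt_const v)
  exact ((hd _).sub ((hd _).const_mul _)).mul_const _

/-- The form `∑ ∂_j f dz_j` of a pluriharmonic function is closed with holomorphic coefficients;
it has a holomorphic primitive `g` on the ball, and then `f - g` is conjugate holomorphic. -/
theorem IsPluriharmonic.exists_isDecomp {f : Cn n → ℂ} (hf : IsPluriharmonic f) :
    ∃ g h, IsDecomp f g h := by
  set pr : Fin n → Cn n →L[ℂ] ℂ := fun j => EuclideanSpace.proj (𝕜 := ℂ) (ι := Fin n) j with hpr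
  have hprv : ∀ j (v : Cn n), pr j v = v j := fun _ _ => rfl
  have hω : ∀ a ∈ unitBall n, HasFDerivWithinAt (fun z => ∑ j, wirt j f z • pr j)
      (∑ j, (fderiv ℝ (wirt j f) a).smulRight (pr j)) (unitBall n) a := by
    intro a ha
    refine HasFDerivWithinAt.fun_sum fun j _ => ?_
    exact ((differentiableAt_wirt (hf.contDiffAt ha) j).hasFDerivAt.smul_const
      (pr j)).hasFDerivWithinAt
  have hzero : ∀ a ∈ unitBall n, ∀ j k, wirtBar k (wirt j f) a = 0 := fun a ha j k => by
    rw [(wirt_wirt_eq (hf.contDiffAt ha) k j).2, hf.2 j k a ha]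
  have hsymm : ∀ a ∈ unitBall n, ∀ x y : Cn n,
      (∑ j, (fderiv ℝ (wirt j f) a).smulRight (pr j)) x y =
        (∑ j, (fderiv ℝ (wirt j f) a).smulRight (pr j)) y x := by
    intro a ha x y
    have e : ∀ x y : Cn n, (∑ j, (fderiv ℝ (wirt j f) a).smulRight (pr j)) x y =
        ∑ j, ∑ k, x k * y j * wirt k (wirt j f) a := by
      intro x y
      simp only [sum_apply, ContinuousLinearMap.smulRight_apply, smul_apply, hprv, smul_eq_mul,
        fderiv_eq_sum_wirt (wirt _ f), hzero a ha, mul_zero, add_zero, Finset.sum_mul]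
      exact Finset.sum_congr rfl fun j _ => Finset.sum_congr rfl fun k _ => by ring
    rw [e, e, Finset.sum_comm]
    refine Finset.sum_congr rfl fun j _ => Finset.sum_congr rfl fun k _ => ?_
    rw [(wirt_wirt_eq (hf.contDiffAt ha) j k).1]
    ring
  -- The Poincaré lemma on the convex ball, over `ℂ`, produces a holomorphic primitive.
  obtain ⟨g, hg⟩ :=
    (convex_ball (0 : Cn n) 1).exists_forall_hasFDerivWithinAt_of_hasFDerivWithinAt_symmetric
      (𝕜 := ℂ) hω (fun a ha x _ y _ => hsymm a ha x y)
  have hg' : ∀ z ∈ unitBall n, HasFDerivAt g (∑ j, wirt j f z • pr j) z := fun z hz =>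
    (hg z hz).hasFDerivAt (isOpen_unitBall.mem_nhds hz)
  refine ⟨g, fun z => conj (f z - g z), fun z hz => (hg z hz).differentiableWithinAt,
    fun z hz => ?_, fun z _ => by simp⟩
  have h1 := ((hf.contDiffAt hz).differentiableAt two_ne_zero).hasFDerivAt.sub
    ((hg' z hz).restrictScalars ℝ)
  have h2 : HasFDerivAt (fun z => conj (f z - g z)) ((Complex.conjCLE : ℂ →L[ℝ] ℂ).comp
      (fderiv ℝ f z - (∑ j, wirt j f z • pr j).restrictScalars ℝ)) z :=
    (Complex.conjCLE : ℂ →L[ℝ] ℂ).hasFDerivAt.comp z h1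
  -- The real derivative is complex linear since `∂_j g = ∂_j f`.
  have h3 : HasFDerivAt (fun z => conj (f z - g z)) (∑ j, conj (wirtBar j f z) • pr j) z := by
    refine hasFDerivAt_of_restrictScalars ℝ h2 ?_
    ext v
    simp only [ContinuousLinearMap.coe_restrictScalars', sum_apply, smul_apply, hprv, smul_eq_mul,
      ContinuousLinearMap.comp_apply, sub_apply, fderiv_eq_sum_wirt f z v,
      ContinuousLinearEquiv.coe_coe, Complex.conjCLE_apply]
    rw [← Finset.sum_sub_distrib, map_sum]
    refine Finset.sum_congr rfl fun j _ => ?_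
    simp only [map_sub, map_add, map_mul, Complex.conj_conj]
    ring
  exact h3.differentiableAt.differentiableWithinAt

/-! ### Seminorms -/

/-- Minkowski's inequality for finite sums. -/
theorem sqrt_sum_le {ι : Type*} (s : Finset ι) {x a b : ι → ℝ≥0∞}
    (h : ∀ i, x i ^ (1 / 2 : ℝ) ≤ a i ^ (1 / 2 : ℝ) + b i ^ (1 / 2 : ℝ)) :
    (∑ i ∈ s, x i) ^ (1 / 2 : ℝ) ≤
      (∑ i ∈ s, a i) ^ (1 / 2 : ℝ) + (∑ i ∈ s, b i) ^ (1 / 2 : ℝ) := by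
  have e : ∀ t : ℝ≥0∞, (t ^ (1 / 2 : ℝ)) ^ (2 : ℝ) = t := fun t => by
    rw [← ENNReal.rpow_mul]; norm_num
  have hM := ENNReal.Lp_add_le s (fun i => a i ^ (1 / 2 : ℝ)) (fun i => b i ^ (1 / 2 : ℝ))
    (one_le_two : (1 : ℝ) ≤ 2)
  simp only [e] at hM
  refine le_trans (ENNReal.rpow_le_rpow (Finset.sum_le_sum fun i _ => ?_) (by norm_num)) hM
  rw [← e (x i)]
  exact ENNReal.rpow_le_rpow (h i) (by norm_num)

/-- Minkowski's inequality in `L²`. -/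
theorem sqrt_lintegral_le {α : Type*} [MeasurableSpace α] {μ : Measure α} {F G H : α → ℂ}
    (hF : AEMeasurable F μ) (hG : AEMeasurable G μ) (h : ∀ᵐ x ∂μ, H x = F x + G x) :
    (∫⁻ x, ‖H x‖ₑ ^ 2 ∂μ) ^ (1 / 2 : ℝ) ≤
      (∫⁻ x, ‖F x‖ₑ ^ 2 ∂μ) ^ (1 / 2 : ℝ) + (∫⁻ x, ‖G x‖ₑ ^ 2 ∂μ) ^ (1 / 2 : ℝ) := by
  have hM := ENNReal.lintegral_Lp_add_le hF.enorm hG.enorm (one_le_two : (1 : ℝ) ≤ 2)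
  simp only [ENNReal.rpow_two, Pi.add_apply] at hM
  refine le_trans (ENNReal.rpow_le_rpow (lintegral_mono_ae ?_) (by norm_num)) hM
  filter_upwards [h] with x hx
  rw [hx]
  exact pow_le_pow_left' (enorm_add_le _ _) 2

theorem sqrt_hardyNormSq_le {F G H : Cn n → ℂ} (hF : ContinuousOn F (unitBall n))
    (hG : ContinuousOn G (unitBall n)) (h : EqOn H (F + G) (unitBall n)) :
    hardyNormSq H ^ (1 / 2 : ℝ) ≤ hardyNormSq F ^ (1 / 2 : ℝ) + hardyNormSq G ^ (1 / 2 : ℝ) := by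
  have e : ∀ t : ℝ≥0∞, (t ^ (1 / 2 : ℝ)) ^ (2 : ℝ) = t := fun t => by
    rw [← ENNReal.rpow_mul]; norm_num
  have e' : ∀ t : ℝ≥0∞, (t ^ (2 : ℝ)) ^ (1 / 2 : ℝ) = t := fun t => by
    rw [← ENNReal.rpow_mul]; norm_num
  rw [← e' (hardyNormSq F ^ (1 / 2 : ℝ) + hardyNormSq G ^ (1 / 2 : ℝ))]
  refine ENNReal.rpow_le_rpow (iSup₂_le fun r hr => ?_) (by norm_num)
  rw [← e (sphereNormSq _)]
  refine ENNReal.rpow_le_rpow (le_trans (sqrt_lintegral_le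
    (continuous_dilate hF hr).measurable.aemeasurable
    (continuous_dilate hG hr).measurable.aemeasurable
    (Filter.Eventually.of_forall fun ζ => h (smul_mem_unitBall hr ζ))) ?_) (by norm_num)
  exact add_le_add
    (ENNReal.rpow_le_rpow (le_iSup₂_of_le (f := fun (r : ℝ) (_ : r ∈ Ioo (0 : ℝ) 1) =>
      sphereNormSq fun ζ => F (r • ζ)) r hr le_rfl) (by norm_num))
    (ENNReal.rpow_le_rpow (le_iSup₂_of_le (f := fun (r : ℝ) (_ : r ∈ Ioo (0 : ℝ) 1) =>
      sphereNormSq fun ζ => G (r • ζ)) r hr le_rfl) (by norm_num))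

theorem ballMeasure_absolutelyContinuous (n : ℕ) (s : ℝ) :
    ballMeasure n s ≪ (volume : Measure (Cn n)).restrict (unitBall n) :=
  withDensity_absolutelyContinuous _ _

theorem sqrt_ballNormSq_le (s : ℝ) {F G H : Cn n → ℂ} (hF : ContinuousOn F (unitBall n))
    (hG : ContinuousOn G (unitBall n)) (h : EqOn H (F + G) (unitBall n)) :
    ballNormSq s H ^ (1 / 2 : ℝ) ≤ ballNormSq s F ^ (1 / 2 : ℝ) + ballNormSq s G ^ (1 / 2 : ℝ) :=
  have ac := ballMeasure_absolutelyContinuous n s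
  sqrt_lintegral_le ((hF.aemeasurable isOpen_unitBall.measurableSet).mono_ac ac)
    ((hG.aemeasurable isOpen_unitBall.measurableSet).mono_ac ac)
    (ac.ae_le ((ae_restrict_mem isOpen_unitBall.measurableSet).mono fun _ hz => h hz))

theorem hardyNormSq_smul (a : ℂ) (F : Cn n → ℂ) :
    hardyNormSq (a • F) = ‖a‖ₑ ^ 2 * hardyNormSq F := by
  simp only [hardyNormSq, ENNReal.mul_iSup]
  exact iSup_congr fun r => iSup_congr fun _ => sphereNormSq_const_mul a fun ζ => F (r • ζ)

theorem ballNormSq_smul (s : ℝ) (a : ℂ) (F : Cn n → ℂ) :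
    ballNormSq s (a • F) = ‖a‖ₑ ^ 2 * ballNormSq s F := by
  simp only [ballNormSq, Pi.smul_apply, smul_eq_mul, enorm_mul, mul_pow]
  exact lintegral_const_mul' _ _ (by simp)

theorem sqrt_sum_smul {ι : Type*} (s : Finset ι) (a : ℂ) {x y : ι → ℝ≥0∞}
    (h : ∀ i, x i = ‖a‖ₑ ^ 2 * y i) :
    (∑ i ∈ s, x i) ^ (1 / 2 : ℝ) = ‖a‖ₑ * (∑ i ∈ s, y i) ^ (1 / 2 : ℝ) := by
  simp only [h]
  rw [← Finset.mul_sum, ENNReal.mul_rpow_of_nonneg _ _ (by norm_num), ← ENNReal.rpow_two,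
    ← ENNReal.rpow_mul]
  norm_num

theorem exists_isDecomp_of_mem {f : Cn n → ℂ} (hf : f ∈ phDirichletSpace n) :
    ∃ g h, IsDecomp f g h ∧ dirichletSq g < ∞ ∧ dirichletSq h < ∞ := by
  obtain ⟨g, hg, h, hh, e⟩ := hf
  exact ⟨g, h, ⟨hg.1, hh.1, e⟩, hg.2, hh.2⟩

theorem mem_phDirichletSpace_iff {f g h : Cn n → ℂ} (d : IsDecomp f g h) :
    f ∈ phDirichletSpace n ↔ phDirichletSq f < ∞ := by
  constructor
  · intro hf
    obtain ⟨g', h', d', hg', hh'⟩ := exists_isDecomp_of_mem hf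
    rw [phDirichletSq_eq d']
    exact ENNReal.add_lt_top.2 ⟨hg', hh'⟩
  · intro hf
    rw [phDirichletSq_eq d, ENNReal.add_lt_top] at hf
    exact ⟨g, ⟨d.1, hf.1⟩, h, ⟨d.2.1, hf.2⟩, d.2.2⟩

/-- The sum `S` is comparable to the squared Dirichlet seminorm for every `f = g + h̄`. -/
def IsComparable (S : (Cn n → ℂ) → ℝ≥0∞) : Prop :=
  ∃ c : ℝ, 0 < c ∧ c ≤ 1 ∧ ∀ f g h : Cn n → ℂ, IsDecomp f g h →
    ENNReal.ofReal c * phDirichletSq f ≤ S f ∧ S f ≤ ENNReal.ofReal c⁻¹ * phDirichletSq f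

theorem IsComparable.lt_top_iff {S : (Cn n → ℂ) → ℝ≥0∞} (hS : IsComparable S) {f g h : Cn n → ℂ}
    (d : IsDecomp f g h) : S f < ∞ ↔ f ∈ phDirichletSpace n := by
  rw [mem_phDirichletSpace_iff d]
  obtain ⟨c, hc0, _, H⟩ := hS
  obtain ⟨h1, h2⟩ := H f g h d
  constructor
  · intro hlt
    by_contra htop
    rw [not_lt, top_le_iff] at htop
    rw [htop, ENNReal.mul_top (by simpa using hc0), top_le_iff] at h1
    exact hlt.ne h1
  · exact fun hlt => h2.trans_lt (ENNReal.mul_lt_top ENNReal.ofReal_lt_top hlt)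

theorem IsComparable.equivOn {S : (Cn n → ℂ) → ℝ≥0∞} (hS : IsComparable S) :
    EquivOn {f : Cn n → ℂ | IsPluriharmonic f} (fun f => phDirichletSq f ^ (1 / 2 : ℝ))
      (fun f => S f ^ (1 / 2 : ℝ)) := by
  obtain ⟨c, hc0, hc1, H⟩ := hS
  refine ⟨c ^ (1 / 2 : ℝ), by positivity, Real.rpow_le_one hc0.le hc1 (by norm_num),
    fun f hf => ?_⟩
  obtain ⟨g, h, d⟩ := IsPluriharmonic.exists_isDecomp (mem_ofPred.1 hf)
  obtain ⟨h1, h2⟩ := H f g h d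
  rw [← Real.inv_rpow hc0.le, ← ENNReal.ofReal_rpow_of_nonneg hc0.le (by norm_num),
    ← ENNReal.ofReal_rpow_of_nonneg (inv_nonneg.2 hc0.le) (by norm_num),
    ← ENNReal.mul_rpow_of_nonneg _ _ (by norm_num), ← ENNReal.mul_rpow_of_nonneg _ _ (by norm_num)]
  exact ⟨ENNReal.rpow_le_rpow h1 (by norm_num), ENNReal.rpow_le_rpow h2 (by norm_num)⟩

theorem IsComparable.sqrt_lt_top {S : (Cn n → ℂ) → ℝ≥0∞} (hS : IsComparable S) {f : Cn n → ℂ}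
    (hf : f ∈ phDirichletSpace n) : S f ^ (1 / 2 : ℝ) < ∞ := by
  obtain ⟨g, h, d, _⟩ := exists_isDecomp_of_mem hf
  exact ENNReal.rpow_lt_top_of_nonneg (by norm_num) ((hS.lt_top_iff d).2 hf).ne

theorem contDiffOn_of_mem {f : Cn n → ℂ} (hf : f ∈ phDirichletSpace n) :
    ContDiffOn ℝ (⊤ : ℕ∞) f (unitBall n) := by
  obtain ⟨g, h, d, _⟩ := exists_isDecomp_of_mem hf
  exact d.contDiffOn

theorem isSeminormOn_tangHardySum {m : ℕ} (hS : IsComparable (n := n) (tangHardySum m)) :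
    IsSeminormOn (phDirichletSpace n) (fun f => tangHardySum m f ^ (1 / 2 : ℝ)) where
  lt_top _ hf := hS.sqrt_lt_top hf
  add_le f hf g hg := sqrt_sum_le _ fun J =>
    have hf' := contDiffOn_of_mem hf
    have hg' := contDiffOn_of_mem hg
    sqrt_hardyNormSq_le (contDiffOn_tangIter isOpen_unitBall hf' J).continuousOn
      (contDiffOn_tangIter isOpen_unitBall hg' J).continuousOn
      (tangIter_add_eqOn isOpen_unitBall hf' hg' J)
  smul_eq a f _ := sqrt_sum_smul _ a fun J => by rw [tangIter_const_smul, hardyNormSq_smul]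

theorem isSeminormOn_tangBallSum {m : ℕ} {s : ℝ} (hS : IsComparable (n := n) (tangBallSum m s)) :
    IsSeminormOn (phDirichletSpace n) (fun f => tangBallSum m s f ^ (1 / 2 : ℝ)) where
  lt_top _ hf := hS.sqrt_lt_top hf
  add_le f hf g hg := sqrt_sum_le _ fun J =>
    have hf' := contDiffOn_of_mem hf
    have hg' := contDiffOn_of_mem hg
    sqrt_ballNormSq_le s (contDiffOn_tangIter isOpen_unitBall hf' J).continuousOn
      (contDiffOn_tangIter isOpen_unitBall hg' J).continuousOn
      (tangIter_add_eqOn isOpen_unitBall hf' hg' J)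
  smul_eq a f _ := sqrt_sum_smul _ a fun J => by rw [tangIter_const_smul, ballNormSq_smul]

end PHDirichlet

end

theorem mainTheorem6 (n : ℕ) (hn : 2 ≤ n) :
    (∀ f : PHDirichlet.Cn n → ℂ, PHDirichlet.IsPluriharmonic f →
      [f ∈ PHDirichlet.phDirichletSpace n,
        PHDirichlet.tangHardySum n f < ∞,
        ∃ k : ℕ, PHDirichlet.tangBallSum (n + k + 1) (k : ℝ) f < ∞,
        ∀ k : ℕ, PHDirichlet.tangBallSum (n + k + 1) (k : ℝ) f < ∞].TFAE) ∧
    (PHDirichlet.IsSeminormOn (PHDirichlet.phDirichletSpace n)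
        (fun f => PHDirichlet.tangHardySum n f ^ (1 / 2 : ℝ)) ∧
      PHDirichlet.EquivOn {f : PHDirichlet.Cn n → ℂ | PHDirichlet.IsPluriharmonic f}
        (fun f => PHDirichlet.phDirichletSq f ^ (1 / 2 : ℝ))
        (fun f => PHDirichlet.tangHardySum n f ^ (1 / 2 : ℝ))) ∧
    (∀ k : ℕ,
      PHDirichlet.IsSeminormOn (PHDirichlet.phDirichletSpace n)
        (fun f => PHDirichlet.tangBallSum (n + k + 1) (k : ℝ) f ^ (1 / 2 : ℝ)) ∧
      PHDirichlet.EquivOn {f : PHDirichlet.Cn n → ℂ | PHDirichlet.IsPluriharmonic f}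
        (fun f => PHDirichlet.phDirichletSq f ^ (1 / 2 : ℝ))
        (fun f => PHDirichlet.tangBallSum (n + k + 1) (k : ℝ) f ^ (1 / 2 : ℝ))) := by
  have hH : PHDirichlet.IsComparable (n := n) (PHDirichlet.tangHardySum n) :=
    PHDirichlet.exists_comparison_tangHardySum n hn
  have hB : ∀ k : ℕ, PHDirichlet.IsComparable (n := n)
      (PHDirichlet.tangBallSum (n + k + 1) (k : ℝ)) :=
    PHDirichlet.exists_comparison_tangBallSum n hn
  refine ⟨fun f hf => ?_, ⟨PHDirichlet.isSeminormOn_tangHardySum hH, hH.equivOn⟩,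
    fun k => ⟨PHDirichlet.isSeminormOn_tangBallSum (hB k), (hB k).equivOn⟩⟩
  obtain ⟨g, h, d⟩ := hf.exists_isDecomp
  simp only [hH.lt_top_iff d, (hB _).lt_top_iff d, exists_const, forall_const]
  tfae_finish
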